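/- Let $N\ge 1$ be an integer, let $\Gamma_\infty=\{\pm\begin{pmatrix}1&n\\0&1\end{pmatrix}:n\in\mathbb Z\}$ and $w_N=\begin{pmatrix}0&-1\\N&0\end{pmatrix}$. Let $\varphi$ be Euler's function and $\mu$ the Möbius function. For $z=x+iy$ in the upper half plane $\mathbb H$ put $$E(N,z,s)=\sum_{\gamma\in\Gamma_\infty\backslash\Gamma_0(N)}(\operatorname{Im}\gamma z)^s,\qquad \mathcal E(N,z,s)=N^{2s}\pi^{-s}\Gamma(s)\zeta^{(N)}(2s)\,E(N,z,s)\qquad(\operatorname{Re}s>1),$$ where $\zeta^{(N)}(s)=\zeta(s)\prod_{p\mid N}(1-p^{-s})$, and let $\zeta^*(s)=\pi^{-s/2}\Gamma(s/2)\zeta(s)$. Let $\Delta(z)=q\prod_{n\ge1}(1-q^n)^{24}$ with $q=e^{2\pi i z}$, and $$\Delta_N(z)=\prod_{t\mid N}\Delta(tz)^{a(t)},\qquad a(t)=\sum_{r\mid t}\mu\!\left(\frac tr\right)\mu\!\left(\frac Nr\right)\frac{\varphi(N)}{\varphi(N/r)}.$$ Let $\Delta_N^0=\Delta_N|w_N$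 in weight $k=12\varphi(N)$, that is, $\Delta_N^0(z)=N^{k/2}(Nz)^{-k}\Delta_N\!\left(-\frac1{Nz}\right)$. Then for every $z\in\mathbb H$ the series $E(N,z,s)$ converges absolutely for $\operatorname{Re}s>1$, the function $s\mapsto\mathcal E(N,z,s)$ continues meromorphically to a neighbourhood of $s=1$, and this continuation, written $\mathcal E(N,z,s)$ again, satisfies (with $s\to1$ through complex values $s\neq1$) $$\lim_{s\to1}\Big(\mathcal E(N,z,s)-\varphi(N)\,\zeta^*(2s-1)\Big)=-\frac1{12}\log\!\big(y^{6\varphi(N)}|\Delta_N(z)|\big)$$ and $$\lim_{s\to1}\Big(\mathcal E(N,w_Nz,s)-\varphi(N)\,\zeta^*(2s-1)\Big)=-\frac1{12}\log\!\big(y^{6\varphi(N)}|\Delta_N^0(z)|\big).$$ -/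

import Mathlib

open Filter Topology UpperHalfPlane
open scoped MatrixGroups

noncomputable section

namespace KroneckerGamma0

/-- The stabilizer `Γ_∞` of the cusp `∞` in `Γ₀(N)`: the matrices `±(1 n; 0 1)`, that is, those
with lower left entry `0`. -/
def GammaInf (N : ℕ) : Subgroup (CongruenceSubgroup.Gamma0 N) where
  carrier := {g | (g : SL(2, ℤ)) 1 0 = 0}
  one_mem' := by simp
  mul_mem' := by
    intro a b ha hb
    have h := (Matrix.two_mul_expl (a : SL(2, ℤ)).1 (b : SL(2, ℤ)).1).2.2.1
    simp only [Set.mem_ofPred_eq] at *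
    simp [h, ha, hb]
  inv_mem' := by
    intro a ha
    simpa [Matrix.SpecialLinearGroup.SL2_inv_expl (a : SL(2, ℤ))] using ha

theorem im_smul_of_lower_left_eq_zero (g : SL(2, ℤ)) (hg : g 1 0 = 0) (z : ℍ) :
    (g • z).im = z.im := by
  have hdet : g 0 0 * g 1 1 = 1 := by
    have h := Matrix.SpecialLinearGroup.det_coe g
    rw [Matrix.det_fin_two, hg] at h
    simpa using h
  have hsq : g 1 1 * g 1 1 = 1 := by
    rcases Int.eq_one_or_neg_one_of_mul_eq_one' hdet with h | h <;> simp [h.2]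
  have hsq' : ((g 1 1 : ℤ) : ℝ) * ((g 1 1 : ℤ) : ℝ) = 1 := by exact_mod_cast hsq
  rw [ModularGroup.im_smul_eq_div_normSq, ModularGroup.denom_apply]
  simp [hg, Complex.normSq_apply, hsq']

/-- The coset space `Γ_∞ \ Γ₀(N)`: two elements `γ`, `γ'` are identified when
`γ' γ⁻¹ ∈ Γ_∞`. -/
abbrev Cosets (N : ℕ) : Type := Quotient (QuotientGroup.rightRel (GammaInf N))

/-- `Im (γ z)`, as a function of the class of `γ` in `Γ_∞ \ Γ₀(N)`. -/
def cosetIm (N : ℕ) (z : ℍ) : Cosets N → ℝ :=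
  Quotient.lift (fun g : CongruenceSubgroup.Gamma0 N => ((g : SL(2, ℤ)) • z).im) <| by
    intro a b hab
    have h : b * a⁻¹ ∈ GammaInf N := QuotientGroup.rightRel_apply.mp hab
    have key := im_smul_of_lower_left_eq_zero ((b * a⁻¹ : CongruenceSubgroup.Gamma0 N) : SL(2, ℤ))
      h ((a : SL(2, ℤ)) • z)
    rw [← mul_smul] at key
    simpa using key.symm

/-- The term `Im (γ z) ^ s` of the Eisenstein series, for a class in `Γ_∞ \ Γ₀(N)`. -/
def eisensteinTerm (N : ℕ) (z : ℍ) (s : ℂ) (γ : Cosets N) : ℂ := (cosetIm N z γ : ℂ) ^ s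

/-- The weight zero Eisenstein series `E(N, z, s) = ∑_{γ ∈ Γ_∞ \ Γ₀(N)} Im (γ z) ^ s`
(used for `Re s > 1`). -/
def eisenstein (N : ℕ) (z : ℍ) (s : ℂ) : ℂ := ∑' γ : Cosets N, eisensteinTerm N z s γ

/-- `ζ^{(N)}(s) = ζ(s) ∏_{p ∣ N} (1 - p^{-s})`. -/
def zetaAway (N : ℕ) (s : ℂ) : ℂ :=
  riemannZeta s * ∏ p ∈ N.primeFactors, (1 - (p : ℂ) ^ (-s))

/-- The normalized series
`𝓔(N, z, s) = N^{2s} π^{-s} Γ(s) ζ^{(N)}(2s) E(N, z, s)` (used for `Re s > 1`). -/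
def normalizedEisenstein (N : ℕ) (z : ℍ) (s : ℂ) : ℂ :=
  (N : ℂ) ^ (2 * s) * (Real.pi : ℂ) ^ (-s) * Complex.Gamma s * zetaAway N (2 * s) *
    eisenstein N z s

/-- `ζ^*(s) = π^{-s/2} Γ(s/2) ζ(s)`. -/
def zetaStar (s : ℂ) : ℂ :=
  (Real.pi : ℂ) ^ (-s / 2) * Complex.Gamma (s / 2) * riemannZeta s

/-- The exponent `a(t) = ∑_{r ∣ t} μ(t/r) μ(N/r) φ(N) / φ(N/r)`, for `t ∣ N`. All the divisions
are exact: `r ∣ t ∣ N`, and `φ(N/r) ∣ φ(N)`. -/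
def deltaExponent (N t : ℕ) : ℤ :=
  ∑ r ∈ t.divisors, ArithmeticFunction.moebius (t / r) * ArithmeticFunction.moebius (N / r) *
    ((Nat.totient N / Nat.totient (N / r) : ℕ) : ℤ)

/-- The exponent `a(t)` is given by the same sum with divisions taken in `ℚ`. -/
theorem deltaExponent_cast {N t : ℕ} (ht : t ∣ N) :
    (deltaExponent N t : ℚ) = ∑ r ∈ t.divisors, (ArithmeticFunction.moebius (t / r) : ℚ) *
      (ArithmeticFunction.moebius (N / r) : ℚ) *
        ((Nat.totient N : ℚ) / (Nat.totient (N / r) : ℚ)) := by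
  unfold deltaExponent
  rw [Int.cast_sum]
  refine Finset.sum_congr rfl fun r hr => ?_
  have hrN : r ∣ N := (Nat.dvd_of_mem_divisors hr).trans ht
  rw [Int.cast_mul, Int.cast_mul, Int.cast_natCast,
    Nat.cast_div_charZero (Nat.totient_dvd_of_dvd (Nat.div_dvd_of_dvd hrN))]

/-- The generalized Delta function `Δ_N(z) = ∏_{t ∣ N} Δ(t z) ^ a(t)` on the upper half plane,
with `Δ = η ^ 24 = q ∏ (1 - q ^ n) ^ 24`. For `t ≥ 1` the number `t z` lies in the upper half plane,
and `ofComplex` is the identity there. -/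
def DeltaN (N : ℕ) (z : ℍ) : ℂ :=
  ∏ t ∈ N.divisors,
    ModularForm.discriminant (UpperHalfPlane.ofComplex ((t : ℂ) * (z : ℂ))) ^ deltaExponent N t

/-- The Fricke matrix `w_N = (0 -1; N 0)`. -/
def frickeMatrix (N : ℕ) [NeZero N] : GL (Fin 2) ℝ :=
  Matrix.GeneralLinearGroup.mkOfDetNeZero !![0, -1; (N : ℝ), 0] (by
    simp [Matrix.det_fin_two, NeZero.ne N])

theorem coe_fricke_smul (N : ℕ) [NeZero N] (z : ℍ) :
    ((frickeMatrix N • z : ℍ) : ℂ) = -1 / ((N : ℂ) * (z : ℂ)) := by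
  have hN : (0 : ℝ) < N := Nat.cast_pos.mpr (NeZero.pos N)
  have hdet : 0 < (frickeMatrix N).det.val := by
    simp [frickeMatrix, Matrix.GeneralLinearGroup.mkOfDetNeZero, Matrix.det_fin_two, hN]
  rw [UpperHalfPlane.coe_smul_of_det_pos hdet]
  simp [UpperHalfPlane.num, UpperHalfPlane.denom, frickeMatrix,
    Matrix.GeneralLinearGroup.mkOfDetNeZero]

/-- The weight `k` slash operator with the normalization
`(f|_k g)(z) = det(g)^{k/2} (c z + d)^{-k} f(g z)`, for `det g > 0`. -/
def slash (k : ℕ) (g : GL (Fin 2) ℝ) (f : ℍ → ℂ) (z : ℍ) : ℂ :=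
  (((g.det.val : ℝ) ^ ((k : ℝ) / 2) : ℝ) : ℂ) * UpperHalfPlane.denom g z ^ (-(k : ℤ)) * f (g • z)

/-- `Δ_N^0 = Δ_N | w_N`, in weight `12 φ(N)`. -/
def DeltaN0 (N : ℕ) [NeZero N] : ℍ → ℂ :=
  slash (12 * Nat.totient N) (frickeMatrix N) (DeltaN N)

end KroneckerGamma0

end

/-!
The Kronecker limit formula for `Γ₀(N)` is reduced to the one for `SL₂(ℤ)`, which is proved by
comparing sums with integrals.

*Unfolding.* The classes in `Γ_∞ \ Γ₀(N)` are the coprime pairs `(c, d)` with `N ∣ c`, up to sign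
(`range_signedRow`). The factor `ζ^{(N)}(2s)` replaces coprimality of `c` and `d` by coprimality of
`d` and `N` (`zetaAway_mul_tsum_primitivePairs`), and a Möbius sum over the divisors of `N` removes
that condition too. Thus (`normalizedEisenstein_eq`)
`𝓔(N, z, s) = ∑_{t ∣ N} μ(N/t) t^s 𝓔(1, tz, s)`, where
`𝓔(1, z, s) = ½ π^{-s} Γ(s) ∑_{(m, n) ≠ 0} y^s |mz + n|^{-2s}` is a completed Epstein zeta function.

*Level one.* The row `m = 0` contributes `ζ(2s)`. In a row `m ≥ 1` the sum over `n` differs from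
the integral over the line by at most the total variation, which is `O(m^{-2 Re s})`
(`norm_lineSum_sub_le`). The differences therefore add up to a function holomorphic for
`Re s > 1/2`, while the integrals add up to `ζ^*(2s - 1) y^{1-s}`. So `𝓔(1, z, s)` equals
`A(z, s) + ζ^*(2s - 1) y^{1-s}` with `A` holomorphic near `1` (`completed_latticeSum_eq`). At
`s = 1` the row sums are given by the partial fraction expansion of the cotangent, and
`A(z, 1) = -(1/12) log |Δ(z)|` by the product formula for `Δ` (`regularPart_one`).

*Level `N`.* Because `t^s (ty)^{1-s} = t y^{1-s}` and `∑_{t ∣ N} μ(N/t) t = φ(N)`, the terms with a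
pole combine to `φ(N) ζ^*(2s - 1) y^{1-s}`; subtracting `φ(N) ζ^*(2s - 1)` leaves
`-½ φ(N) log y` in the limit, `ζ^*(2s - 1)` having residue `½`. The remaining part is
`∑_{t ∣ N} μ(N/t) t A(tz, 1)`, and this is `-(1/12) log |Δ_N(z)|` because the exponent `a(t)` equals
`t μ(N/t)` (`deltaExponent_eq`). The second limit is the first one at `w_N z`, rewritten with
`Im (w_N z) = y / (N |z|²)`.
-/

noncomputable section

namespace KroneckerGamma0

open MeasureTheory

/-! ### Sums over a horizontal line of lattice points -/

/-- The term `|w + n| ^ (-2 s)` of the sum over the translates of `w` by integers. -/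
def lineTerm (w s : ℂ) (n : ℤ) : ℂ := (Complex.normSq (w + n) : ℂ) ^ (-s)

/-- The sum `∑_{n ∈ ℤ} |w + n| ^ (-2 s)` (used for `Re s > 1 / 2` and `w` not real). -/
def lineSum (w s : ℂ) : ℂ := ∑' n : ℤ, lineTerm w s n

theorem normSq_add_intCast_pos {w : ℂ} (hw : w.im ≠ 0) (n : ℤ) :
    0 < Complex.normSq (w + n) := by
  refine Complex.normSq_pos.mpr fun h => hw ?_
  simpa using congrArg Complex.im h

theorem norm_lineTerm {w : ℂ} (hw : w.im ≠ 0) (s : ℂ) (n : ℤ) :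
    ‖lineTerm w s n‖ = Complex.normSq (w + n) ^ (-s.re) := by
  rw [lineTerm, Complex.norm_cpow_eq_rpow_re_of_pos (normSq_add_intCast_pos hw n), Complex.neg_re]

theorem summable_normSq_rpow (w : ℂ) {σ : ℝ} (hσ : 1 / 2 < σ) :
    Summable fun n : ℤ => Complex.normSq (w + n) ^ (-σ) := by
  have h1 : (fun n : ℤ => ‖(w + n)⁻¹‖ ^ (2 * σ)) =O[cofinite]
      fun n : ℤ => (|(n : ℝ)|⁻¹) ^ (2 * σ) := by
    refine Asymptotics.IsBigO.rpow (by linarith) (Eventually.of_forall fun n => by positivity) ?_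
    have := (EisensteinSeries.linear_isTheta_right_add 1 0 w).inv.isBigO.norm_norm
    simpa using this
  refine summable_of_isBigO (Real.summable_abs_int_rpow (b := 2 * σ) (by linarith)) ?_
  refine (h1.congr (fun n => ?_) fun n => ?_)
  · rw [norm_inv, Real.inv_rpow (norm_nonneg _), ← Real.rpow_neg (norm_nonneg _),
      Complex.normSq_eq_norm_sq, ← Real.rpow_natCast, ← Real.rpow_mul (norm_nonneg _)]
    congr 1
    push_cast
    ring
  · rw [Real.inv_rpow (abs_nonneg _), ← Real.rpow_neg (abs_nonneg _)]

theorem summable_lineTerm {w : ℂ} (hw : w.im ≠ 0) {s : ℂ} (hs : 1 / 2 < s.re) :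
    Summable (lineTerm w s) := by
  refine Summable.of_norm ?_
  simpa only [norm_lineTerm hw] using summable_normSq_rpow w hs

theorem differentiableOn_lineSum {w : ℂ} (hw : w.im ≠ 0) :
    DifferentiableOn ℂ (lineSum w) {s | 1 / 2 < s.re} := by
  intro s₀ hs₀
  obtain ⟨a, ha, ha'⟩ := exists_between (show 1 / 2 < s₀.re from hs₀)
  have hopen : IsOpen {s : ℂ | a < s.re ∧ s.re < s₀.re + 1} :=
    (isOpen_lt continuous_const Complex.continuous_re).inter
      (isOpen_lt Complex.continuous_re continuous_const)
  have key : DifferentiableOn ℂ (fun s => ∑' n : ℤ, lineTerm w s n)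
      {s : ℂ | a < s.re ∧ s.re < s₀.re + 1} := by
    refine Complex.differentiableOn_tsum_of_summable_norm
      (u := fun n : ℤ => Complex.normSq (w + n) ^ (-a) + Complex.normSq (w + n) ^ (-(s₀.re + 1)))
      ((summable_normSq_rpow w ha).add
        (summable_normSq_rpow w (by linarith))) (fun n s _ => ?_) hopen ?_
    · have h0 : (Complex.normSq (w + n) : ℂ) ≠ 0 :=
        Complex.ofReal_ne_zero.mpr (normSq_add_intCast_pos hw n).ne'
      exact (differentiableAt_id.neg.const_cpow (Or.inl h0)).differentiableWithinAt
    · rintro n s ⟨h1, h2⟩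
      rw [norm_lineTerm hw]
      have hx := normSq_add_intCast_pos hw n
      -- the first bound serves where the base is at least `1`, the second where it is less
      rcases le_total 1 (Complex.normSq (w + n)) with h | h
      · exact (Real.rpow_le_rpow_of_exponent_le h (by linarith)).trans
          (le_add_of_nonneg_right (by positivity))
      · exact (Real.rpow_le_rpow_of_exponent_ge hx h (by linarith)).trans
          (le_add_of_nonneg_left (by positivity))
  exact (key.differentiableAt (hopen.mem_nhds ⟨ha', by linarith⟩)).differentiableWithinAt

/-- A sum over the integers differs from the integral over the line by at most the total
variation. -/
theorem norm_tsum_sub_integral_le {f f' : ℝ → ℂ} (hf : ∀ x, HasDerivAt f (f' x) x)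
    (hfi : Integrable f) (hf'i : Integrable f') (hs : Summable fun n : ℤ => f n) :
    ‖∑' n : ℤ, f n - ∫ x, f x‖ ≤ ∫ x, ‖f' x‖ := by
  have h1 : HasSum (fun n : ℤ => ∫ x in (n : ℝ)..n + 1, f x) (∫ x, f x) := by
    simpa using hfi.hasSum_intervalIntegral 0
  have h2 : HasSum (fun n : ℤ => ∫ x in (n : ℝ)..n + 1, ‖f' x‖) (∫ x, ‖f' x‖) := by
    simpa using hf'i.norm.hasSum_intervalIntegral 0
  rw [← (hs.hasSum.sub h1).tsum_eq, ← h2.tsum_eq]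
  refine tsum_of_norm_bounded h2.summable.hasSum fun n => ?_
  have hle : (n : ℝ) ≤ n + 1 := by linarith
  have h3 : f n - ∫ x in (n : ℝ)..n + 1, f x = ∫ x in (n : ℝ)..n + 1, (f n - f x) := by
    rw [intervalIntegral.integral_sub (by simp) hfi.intervalIntegrable]
    simp
  rw [h3]
  refine (intervalIntegral.norm_integral_le_of_norm_le_const
    (C := ∫ x in (n : ℝ)..n + 1, ‖f' x‖) fun x hx => ?_).trans (by simp)
  rw [Set.uIoc_of_le hle] at hx
  have h4 : ∫ t in (n : ℝ)..x, f' t = f x - f n :=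
    intervalIntegral.integral_eq_sub_of_hasDerivAt (fun t _ => hf t) hf'i.intervalIntegrable
  rw [norm_sub_rev, ← h4]
  refine (intervalIntegral.norm_integral_le_integral_norm hx.1.le).trans ?_
  exact intervalIntegral.integral_mono_interval le_rfl hx.1.le hx.2
    (Eventually.of_forall fun t => norm_nonneg _) hf'i.norm.intervalIntegrable

/-! ### The integral over a horizontal line -/

theorem integral_inv_sq_add_sq {a : ℝ} (ha : 0 < a) :
    Integrable (fun v : ℝ => (v ^ 2 + a ^ 2)⁻¹) ∧ ∫ v : ℝ, (v ^ 2 + a ^ 2)⁻¹ = Real.pi / a := by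
  have h : (fun v : ℝ => (v ^ 2 + a ^ 2)⁻¹) = fun v => (a ^ 2)⁻¹ * (1 + (a⁻¹ * v) ^ 2)⁻¹ := by
    funext v
    rw [← mul_inv]
    congr 1
    field_simp
    ring
  rw [h]
  refine ⟨(integrable_inv_one_add_sq.comp_mul_left' (inv_ne_zero ha.ne')).const_mul _, ?_⟩
  rw [integral_const_mul, Measure.integral_comp_mul_left (fun v : ℝ => (1 + v ^ 2)⁻¹),
    integral_univ_inv_one_add_sq, inv_inv, abs_of_pos ha, smul_eq_mul]
  field_simp

theorem ofReal_sq_cpow {a : ℝ} (ha : 0 < a) (s : ℂ) :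
    ((a ^ 2 : ℝ) : ℂ) ^ s = (a : ℂ) ^ (2 * s) := by
  have h := Complex.cpow_nat_mul' (x := (a : ℂ)) (n := 2)
    (by rw [Complex.arg_ofReal_of_nonneg ha.le]; simpa using Real.pi_pos)
    (by rw [Complex.arg_ofReal_of_nonneg ha.le]; simpa using Real.pi_pos.le) s
  rw [Complex.ofReal_pow, ← h, Nat.cast_ofNat]

theorem continuous_sq_add_sq_cpow {a : ℝ} (ha : 0 < a) (s : ℂ) :
    Continuous fun v : ℝ => ((v ^ 2 + a ^ 2 : ℝ) : ℂ) ^ s := by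
  refine Continuous.cpow (by fun_prop) continuous_const fun v => ?_
  exact Complex.ofReal_mem_slitPlane.mpr (by positivity)

theorem integrable_sq_add_sq_cpow {a : ℝ} (ha : 0 < a) {s : ℂ} (hs : 1 / 2 < s.re) :
    Integrable fun v : ℝ => ((v ^ 2 + a ^ 2 : ℝ) : ℂ) ^ (-s) := by
  have h1 : Integrable fun v : ℝ => (1 + ‖v‖ ^ 2) ^ (-(2 * s.re) / 2) :=
    integrable_rpow_neg_one_add_norm_sq (by simp; linarith)
  set c : ℝ := min 1 (a ^ 2)
  have hc : 0 < c := lt_min one_pos (by positivity)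
  refine (h1.const_mul (c ^ (-s.re))).mono'
    (continuous_sq_add_sq_cpow ha (-s)).aestronglyMeasurable (Eventually.of_forall fun v => ?_)
  rw [Complex.norm_cpow_eq_rpow_re_of_pos (by positivity), Complex.neg_re, Real.norm_eq_abs,
    sq_abs, show -(2 * s.re) / 2 = -s.re by ring, ← Real.mul_rpow hc.le (by positivity)]
  refine Real.rpow_le_rpow_of_nonpos (by positivity) ?_ (by linarith)
  have h2 : c ≤ 1 := min_le_left _ _
  have h3 : c ≤ a ^ 2 := min_le_right _ _
  nlinarith [sq_nonneg v]

/-- The values of the Beta integral over a line, from the integral representation of `Γ` and the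
Gaussian integral. -/
theorem integral_sq_add_sq_cpow {a : ℝ} (ha : 0 < a) {s : ℂ} (hs : 1 / 2 < s.re) :
    ∫ v : ℝ, ((v ^ 2 + a ^ 2 : ℝ) : ℂ) ^ (-s) =
      (a : ℂ) ^ (1 - 2 * s) * (Real.sqrt Real.pi : ℂ) * Complex.Gamma (s - 1 / 2) /
        Complex.Gamma s := by
  have hs0 : 0 < s.re := by linarith
  set f : ℝ → ℝ → ℂ := fun v t => (t : ℂ) ^ (s - 1) * (Real.exp (-((v ^ 2 + a ^ 2) * t)) : ℂ)
  -- the inner integral over `t`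
  have hinner1 : ∀ v : ℝ, ∫ t in Set.Ioi (0 : ℝ), f v t =
      ((v ^ 2 + a ^ 2 : ℝ) : ℂ) ^ (-s) * Complex.Gamma s := by
    intro v
    have hx : 0 < v ^ 2 + a ^ 2 := by positivity
    have h := Complex.integral_cpow_mul_exp_neg_mul_Ioi hs0 hx
    have h2 : ((1 : ℂ) / ((v ^ 2 + a ^ 2 : ℝ) : ℂ)) ^ s = ((v ^ 2 + a ^ 2 : ℝ) : ℂ) ^ (-s) := by
      rw [one_div, Complex.inv_cpow _ _ (by
        rw [Complex.arg_ofReal_of_nonneg hx.le]; exact Real.pi_pos.ne), Complex.cpow_neg]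
    rw [← h2, ← h]
    refine setIntegral_congr_fun measurableSet_Ioi fun t _ => ?_
    simp [f]
  -- the inner integral over `v`
  have hgauss : ∀ t : ℝ, 0 < t → ∫ v : ℝ, Real.exp (-((v ^ 2 + a ^ 2) * t)) =
      Real.sqrt Real.pi * (t ^ (-(1 / 2) : ℝ) * Real.exp (-(a ^ 2 * t))) := by
    intro t ht
    have h : ∀ v : ℝ, Real.exp (-((v ^ 2 + a ^ 2) * t)) =
        Real.exp (-t * v ^ 2) * Real.exp (-(a ^ 2 * t)) := by
      intro v
      rw [← Real.exp_add]
      ring_nf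
    simp_rw [h]
    rw [integral_mul_const, integral_gaussian, Real.sqrt_div Real.pi_pos.le, Real.sqrt_eq_rpow t,
      Real.rpow_neg ht.le]
    ring
  have hnorm : ∀ t : ℝ, 0 < t → ∀ v, ‖f v t‖ =
      t ^ (s.re - 1) * Real.exp (-((v ^ 2 + a ^ 2) * t)) := by
    intro t ht v
    simp only [f]
    rw [norm_mul, Complex.norm_cpow_eq_rpow_re_of_pos ht, Complex.norm_real, Real.norm_eq_abs,
      abs_of_pos (Real.exp_pos _)]
    simp
  have hinner2 : ∀ t : ℝ, 0 < t → ∫ v : ℝ, f v t = (Real.sqrt Real.pi : ℂ) *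
      ((t : ℂ) ^ ((s - 1 / 2) - 1) * Complex.exp (-(((a ^ 2 : ℝ) : ℂ) * t))) := by
    intro t ht
    simp only [f]
    rw [integral_const_mul, integral_complex_ofReal, hgauss t ht]
    have : (t : ℂ) ^ ((s - 1 / 2) - 1) = (t : ℂ) ^ (s - 1) * ((t ^ (-(1 / 2) : ℝ) : ℝ) : ℂ) := by
      rw [Complex.ofReal_cpow ht.le, ← Complex.cpow_add _ _ (Complex.ofReal_ne_zero.mpr ht.ne')]
      congr 1
      push_cast
      ring
    rw [this]
    push_cast
    ring
  have hmeas : Measurable (Function.uncurry f) := by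
    refine Measurable.mul ?_ ?_
    · exact Measurable.pow_const (Complex.measurable_ofReal.comp measurable_snd) _
    · exact Complex.measurable_ofReal.comp (by fun_prop)
  have hint : Integrable (Function.uncurry f)
      ((volume : Measure ℝ).prod (volume.restrict (Set.Ioi (0 : ℝ)))) := by
    rw [integrable_prod_iff' hmeas.aestronglyMeasurable]
    constructor
    · refine (ae_restrict_mem measurableSet_Ioi).mono fun t ht => ?_
      have ht' : (0 : ℝ) < t := ht
      have h1 : Integrable fun v : ℝ => ‖f v t‖ := by
        simp_rw [hnorm t ht']
        refine Integrable.const_mul ?_ _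
        refine ((integrable_exp_neg_mul_sq ht').mul_const (Real.exp (-(a ^ 2 * t)))).congr
          (Eventually.of_forall fun v => ?_)
        simp only
        rw [← Real.exp_add]
        ring_nf
      refine h1.mono' ?_ (Eventually.of_forall fun v => le_rfl)
      exact (hmeas.comp measurable_prodMk_right).aestronglyMeasurable
    · have h2 : IntegrableOn (fun t : ℝ => Real.sqrt Real.pi *
          (t ^ (s.re - 1 / 2 - 1) * Real.exp (-(a ^ 2) * t))) (Set.Ioi 0) := by
        refine Integrable.const_mul ?_ _
        have := integrableOn_rpow_mul_exp_neg_mul_rpow (s := s.re - 1 / 2 - 1) (p := 1)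
          (b := a ^ 2) (by linarith) one_pos (by positivity)
        simpa [IntegrableOn] using this
      refine h2.congr_fun (fun t ht => ?_) measurableSet_Ioi
      have ht' : (0 : ℝ) < t := ht
      simp only [Function.uncurry_apply_pair]
      simp_rw [hnorm t ht']
      rw [integral_const_mul, hgauss t ht',
        show s.re - 1 / 2 - 1 = (s.re - 1) + (-(1 / 2)) by ring, Real.rpow_add ht']
      ring_nf
  have hswap := integral_integral_swap hint
  simp_rw [hinner1] at hswap
  rw [integral_mul_const, setIntegral_congr_fun measurableSet_Ioi fun t ht => hinner2 t ht,
    integral_const_mul, Complex.integral_cpow_mul_exp_neg_mul_Ioi (by simp; linarith)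
      (show (0 : ℝ) < a ^ 2 by positivity)] at hswap
  rw [eq_div_iff (Complex.Gamma_ne_zero_of_re_pos hs0), hswap]
  have h3 : ((1 : ℂ) / ((a ^ 2 : ℝ) : ℂ)) ^ (s - 1 / 2) = (a : ℂ) ^ (1 - 2 * s) := by
    rw [one_div, Complex.inv_cpow _ _ (by
      rw [Complex.arg_ofReal_of_nonneg (by positivity)]; exact Real.pi_pos.ne), ← Complex.cpow_neg,
      ofReal_sq_cpow ha]
    ring_nf
  rw [h3]
  ring

/-- The integral over the line is the main term of `lineSum w s`. The error is of order
`(Im w) ^ (-2 Re s)`, hence summable over the rows of a lattice as soon as `Re s > 1 / 2`. -/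
theorem norm_lineSum_sub_le {w : ℂ} (hw : 0 < w.im) {s : ℂ} (hs : 1 / 2 < s.re) :
    ‖lineSum w s - (w.im : ℂ) ^ (1 - 2 * s) * (Real.sqrt Real.pi : ℂ) *
      Complex.Gamma (s - 1 / 2) / Complex.Gamma s‖ ≤
      2 * Real.pi * ‖s‖ * w.im ^ (-(2 * s.re)) := by
  set a := w.im
  set b := w.re
  set g : ℝ → ℂ := fun v => ((v ^ 2 + a ^ 2 : ℝ) : ℂ) ^ (-s)
  set g' : ℝ → ℂ := fun v => -s * ((v ^ 2 + a ^ 2 : ℝ) : ℂ) ^ (-s - 1) * ((2 * v : ℝ) : ℂ)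
  have hpos : ∀ v : ℝ, 0 < v ^ 2 + a ^ 2 := fun v => by positivity
  have hg : ∀ v, HasDerivAt g (g' v) v := by
    intro v
    have h1 : HasDerivAt (fun v : ℝ => ((v ^ 2 + a ^ 2 : ℝ) : ℂ)) ((2 * v : ℝ) : ℂ) v := by
      refine HasDerivAt.ofReal_comp ?_
      simpa using (hasDerivAt_pow 2 v).add_const (a ^ 2)
    exact (Complex.hasStrictDerivAt_cpow_const (c := -s)
      (Complex.ofReal_mem_slitPlane.mpr (hpos v))).hasDerivAt.comp v h1
  have hgi : Integrable g := integrable_sq_add_sq_cpow hw hs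
  have hbound : ∀ v, ‖g' v‖ ≤ 2 * ‖s‖ * a ^ (1 - 2 * s.re) * (v ^ 2 + a ^ 2)⁻¹ := by
    intro v
    have hx := hpos v
    have h1 : |v| ≤ (v ^ 2 + a ^ 2) ^ (1 / 2 : ℝ) := by
      rw [← Real.sqrt_eq_rpow]
      exact Real.abs_le_sqrt (by nlinarith [sq_nonneg a])
    have h2 : (v ^ 2 + a ^ 2) ^ (-(s.re - 1 / 2)) ≤ a ^ (1 - 2 * s.re) := by
      have h3 : a ^ (1 - 2 * s.re) = (a ^ 2) ^ (-(s.re - 1 / 2)) := by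
        rw [← Real.rpow_natCast, ← Real.rpow_mul hw.le]
        congr 1
        push_cast
        ring
      rw [h3]
      exact Real.rpow_le_rpow_of_nonpos (by positivity) (by nlinarith [sq_nonneg v]) (by linarith)
    simp only [g']
    rw [norm_mul, norm_mul, norm_neg, Complex.norm_cpow_eq_rpow_re_of_pos hx, Complex.norm_real,
      Real.norm_eq_abs, abs_mul, abs_two]
    have h4 : (v ^ 2 + a ^ 2) ^ (-s - 1).re * (v ^ 2 + a ^ 2) ^ (1 / 2 : ℝ) =
        (v ^ 2 + a ^ 2) ^ (-(s.re - 1 / 2)) * (v ^ 2 + a ^ 2)⁻¹ := by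
      rw [← Real.rpow_neg_one, ← Real.rpow_add hx, ← Real.rpow_add hx]
      congr 1
      simp
      ring
    calc ‖s‖ * (v ^ 2 + a ^ 2) ^ (-s - 1).re * (2 * |v|)
        ≤ ‖s‖ * (v ^ 2 + a ^ 2) ^ (-s - 1).re * (2 * (v ^ 2 + a ^ 2) ^ (1 / 2 : ℝ)) := by gcongr
      _ = 2 * ‖s‖ * ((v ^ 2 + a ^ 2) ^ (-(s.re - 1 / 2)) * (v ^ 2 + a ^ 2)⁻¹) := by
          rw [← h4]; ring
      _ ≤ 2 * ‖s‖ * (a ^ (1 - 2 * s.re) * (v ^ 2 + a ^ 2)⁻¹) := by gcongr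
      _ = _ := by ring
  obtain ⟨hi, hI⟩ := integral_inv_sq_add_sq hw
  have hg'i : Integrable g' := by
    refine (hi.const_mul (2 * ‖s‖ * a ^ (1 - 2 * s.re))).mono' ?_ (Eventually.of_forall hbound)
    refine Continuous.aestronglyMeasurable ?_
    exact (continuous_const.mul (continuous_sq_add_sq_cpow hw _)).mul (by fun_prop)
  have hline : ∀ n : ℤ, lineTerm w s n = g ((n : ℝ) + b) := by
    intro n
    simp only [lineTerm, g, Complex.normSq_apply]
    congr 2
    simp [a, b]
    ring
  have hsum : Summable fun n : ℤ => g ((n : ℝ) + b) := by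
    simpa only [← hline] using summable_lineTerm hw.ne' hs
  have key := norm_tsum_sub_integral_le (f := fun v => g (v + b)) (f' := fun v => g' (v + b))
    (fun x => (hg (x + b)).comp_add_const x b) (hgi.comp_add_right b) (hg'i.comp_add_right b) hsum
  rw [integral_add_right_eq_self g, integral_add_right_eq_self (fun v => ‖g' v‖),
    integral_sq_add_sq_cpow hw hs] at key
  rw [lineSum, tsum_congr hline]
  refine key.trans ((integral_mono hg'i.norm (hi.const_mul _) hbound).trans (le_of_eq ?_))
  rw [integral_const_mul, hI, show (1 - 2 * s.re) = -(2 * s.re) + 1 by ring, Real.rpow_add hw,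
    Real.rpow_one]
  field_simp

/-! ### The values at `s = 1` and the discriminant -/

/-- At `s = 1` the sum over a line is minus the imaginary part of `π cot (π w)`, because
`Im w / |w + n| ^ 2 = -Im (1 / (w + n))`. -/
theorem im_mul_lineSum_one (w : ℍ) :
    (w.im : ℂ) * lineSum w 1 = ((Real.pi + 2 * Real.pi *
      (∑' k : ℕ, Complex.exp (2 * Real.pi * Complex.I * w) ^ (k + 1)).re : ℝ) : ℂ) := by
  set q : ℂ := Complex.exp (2 * Real.pi * Complex.I * w)
  have hq : ‖q‖ < 1 := norm_exp_two_pi_I_lt_one w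
  set t : ℤ → ℝ := fun n => -(1 / ((w : ℂ) + n)).im
  have ht : ∀ n : ℤ, (w.im : ℂ) * lineTerm w 1 n = (t n : ℂ) := by
    intro n
    simp only [lineTerm, t, one_div, Complex.inv_im, Complex.cpow_neg_one]
    simp [div_eq_mul_inv]
  have hts : Summable t := by
    refine Complex.summable_ofReal.mp ?_
    simp_rw [← ht]
    exact (summable_lineTerm w.im_ne_zero (by norm_num)).mul_left _
  have h1 : Summable fun n : ℕ => t (n + 1 : ℕ) :=
    hts.comp_injective (i := fun n : ℕ => ((n + 1 : ℕ) : ℤ)) fun a b h => by simpa using h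
  have h2 : Summable fun n : ℕ => t (-((n + 1 : ℕ) : ℤ)) :=
    hts.comp_injective (i := fun n : ℕ => -((n + 1 : ℕ) : ℤ)) fun a b h => by simpa using h
  have hcot := cot_series_rep' (UpperHalfPlane.coe_mem_integerComplement w)
  have hcs := summable_cotTerm (UpperHalfPlane.coe_mem_integerComplement w)
  have hsum : ∑' n, t n = -(Real.pi * Complex.cot (Real.pi * w)).im := by
    have h3 : ∑' n, t n = t 0 + ∑' n : ℕ, (t (n + 1 : ℕ) + t (-((n + 1 : ℕ) : ℤ))) := by
      rw [h1.tsum_add h2]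
      have := tsum_of_add_one_of_neg_add_one (f := t) (by simpa using h1) (by simpa using h2)
      rw [this]
      push_cast
      ring
    have h4 : ∑' n : ℕ, (t (n + 1 : ℕ) + t (-((n + 1 : ℕ) : ℤ))) =
        -(Real.pi * Complex.cot (Real.pi * w) - 1 / (w : ℂ)).im := by
      rw [hcot, Complex.im_tsum hcs, ← tsum_neg]
      refine tsum_congr fun n => ?_
      simp only [t, Complex.add_im]
      push_cast
      rw [← sub_eq_add_neg]
      ring_nf
    rw [h3, h4, Complex.sub_im]
    simp only [t]
    push_cast
    rw [add_zero]
    ring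
  rw [lineSum, ← tsum_mul_left, tsum_congr ht, ← Complex.ofReal_tsum, hsum, pi_mul_cot_pi_q_exp]
  congr 1
  have h5 : ∑' n : ℕ, q ^ n = 1 + ∑' k : ℕ, q ^ (k + 1) := by
    rw [(summable_geometric_of_norm_lt_one hq).tsum_eq_zero_add, pow_zero]
  rw [h5]
  simp [Complex.mul_im, Complex.mul_re]
  ring

/-- The logarithmic series for `log |1 - q ^ k|`, summed over `k`, with the two
summations exchanged. -/
theorem tsum_re_tsum_pow_div {q : ℂ} (hq : ‖q‖ < 1) :
    ∑' m : ℕ, (∑' k : ℕ, (q ^ (m + 1)) ^ (k + 1)).re / (m + 1) =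
      -∑' k : ℕ, Real.log ‖1 - q ^ (k + 1)‖ := by
  set g : ℕ → ℕ → ℝ := fun m k => (q ^ ((m + 1) * (k + 1))).re / (m + 1)
  have hgs : Summable (Function.uncurry g) := by
    have h0 := summable_geometric_of_lt_one (norm_nonneg q) hq
    refine Summable.of_norm_bounded
      (h0.mul_of_nonneg h0 (fun n => by positivity) (fun n => by positivity)) ?_
    rintro ⟨m, k⟩
    simp only [Function.uncurry_apply_pair, g]
    rw [Real.norm_eq_abs, abs_div, abs_of_pos (show (0 : ℝ) < m + 1 by positivity)]
    calc |(q ^ ((m + 1) * (k + 1))).re| / (m + 1) ≤ |(q ^ ((m + 1) * (k + 1))).re| :=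
          div_le_self (abs_nonneg _) (by linarith [(Nat.cast_nonneg m : (0 : ℝ) ≤ m)])
      _ ≤ ‖q ^ ((m + 1) * (k + 1))‖ := Complex.abs_re_le_norm _
      _ = ‖q‖ ^ ((m + 1) * (k + 1)) := norm_pow _ _
      _ ≤ ‖q‖ ^ (m + k) := pow_le_pow_of_le_one (norm_nonneg _) hq.le (by nlinarith)
      _ = ‖q‖ ^ m * ‖q‖ ^ k := pow_add _ _ _
  have hpow : ∀ n : ℕ, ‖q ^ (n + 1)‖ < 1 := fun n => by
    rw [norm_pow]; exact pow_lt_one₀ (norm_nonneg _) hq (Nat.succ_ne_zero n)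
  have h1 : ∀ m : ℕ, (∑' k : ℕ, (q ^ (m + 1)) ^ (k + 1)).re / (m + 1) = ∑' k, g m k := by
    intro m
    have hs : Summable fun k : ℕ => (q ^ (m + 1)) ^ (k + 1) :=
      (summable_nat_add_iff 1).mpr (summable_geometric_of_norm_lt_one (hpow m))
    rw [Complex.re_tsum hs, ← tsum_div_const]
    exact tsum_congr fun k => by simp only [g, pow_mul]
  have h2 : ∀ k : ℕ, ∑' m, g m k = -Real.log ‖1 - q ^ (k + 1)‖ := by
    intro k
    have h := Complex.hasSum_taylorSeries_neg_log (hpow k)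
    rw [← hasSum_nat_add_iff' 1] at h
    have h3 := (Complex.hasSum_re h).tsum_eq
    simp only [Finset.range_one, Finset.sum_singleton, pow_zero, Nat.cast_zero, div_zero,
      sub_zero, Complex.neg_re, Complex.log_re] at h3
    rw [← h3]
    refine tsum_congr fun m => ?_
    simp only [g]
    rw [← pow_mul, mul_comm (k + 1), ← Complex.ofReal_natCast, Complex.div_ofReal_re]
    push_cast
    rfl
  rw [tsum_congr h1, ← tsum_neg, ← tsum_congr h2]
  exact hgs.tsum_comm.symm

theorem log_norm_discriminant (z : ℍ) :
    Real.log ‖ModularForm.discriminant z‖ = -(2 * Real.pi * z.im) + 24 *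
      ∑' k : ℕ, Real.log ‖1 - Complex.exp (2 * Real.pi * Complex.I * z) ^ (k + 1)‖ := by
  set q : ℂ := Complex.exp (2 * Real.pi * Complex.I * z)
  have hq : ‖q‖ < 1 := norm_exp_two_pi_I_lt_one z
  have hpow : ∀ n : ℕ, ‖q ^ (n + 1)‖ < 1 := fun n => by
    rw [norm_pow]; exact pow_lt_one₀ (norm_nonneg _) hq (Nat.succ_ne_zero n)
  have hne : ∀ n : ℕ, 1 - q ^ (n + 1) ≠ 0 := fun n h => by
    have := hpow n
    rw [← sub_eq_zero.mp h] at this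
    simp at this
  have hlog : Summable fun n : ℕ => Real.log ‖1 - q ^ (n + 1)‖ := by
    have h : Summable fun n : ℕ => Complex.log (1 + -q ^ (n + 1)) := by
      refine Complex.summable_log_one_add_of_summable ?_
      have := (summable_nat_add_iff 1).mpr (summable_geometric_of_lt_one (norm_nonneg q) hq)
      exact Summable.of_norm (by simpa using this)
    refine (Complex.hasSum_re h.hasSum).summable.congr fun n => ?_
    rw [Complex.log_re, sub_eq_add_neg]
  have hmul := ModularForm.multipliable_one_sub_pow hq
  have hprod : Real.log ‖∏' n : ℕ, (1 - q ^ (n + 1))‖ = ∑' n : ℕ, Real.log ‖1 - q ^ (n + 1)‖ := by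
    rw [hmul.norm_tprod, ← Real.rexp_tsum_eq_tprod (fun n => norm_pos_iff.mpr (hne n)) hlog,
      Real.log_exp]
  have hqp : Function.Periodic.qParam 1 z = q := by simp [Function.Periodic.qParam, q]
  have hnq : ‖Function.Periodic.qParam 24 z‖ = Real.exp (-(2 * Real.pi * z.im) / 24) := by
    rw [Function.Periodic.norm_qParam]
    congr 1
    simp
  have heta : ∏' n : ℕ, (1 - ModularForm.eta_q n z) = ∏' n : ℕ, (1 - q ^ (n + 1)) := by
    simp only [ModularForm.eta_q, hqp]
  have hne' : ‖∏' n : ℕ, (1 - q ^ (n + 1))‖ ≠ 0 := by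
    rw [← heta]
    exact norm_ne_zero_iff.mpr (ModularForm.eta_tprod_ne_zero z.2)
  rw [ModularForm.discriminant, norm_pow, Real.log_pow, ModularForm.eta, norm_mul, heta, hnq,
    Real.log_mul (Real.exp_ne_zero _) hne', Real.log_exp, hprod]
  push_cast
  ring

/-! ### The Epstein zeta function of a lattice -/

/-- The term `(Im z / |m z + n| ^ 2) ^ s` of the Epstein zeta function of the lattice `ℤ z + ℤ`.
For `(m, n) = (0, 0)` and `s ≠ 0` it is `0`. -/
def latticeTerm (z : ℍ) (s : ℂ) (p : ℤ × ℤ) : ℂ :=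
  ((z.im / Complex.normSq (p.1 * z + p.2) : ℝ) : ℂ) ^ s

/-- The Epstein zeta function `∑_{(m, n) ≠ 0} (Im z / |m z + n| ^ 2) ^ s`
(used for `Re s > 1`). -/
def latticeSum (z : ℍ) (s : ℂ) : ℂ := ∑' p : ℤ × ℤ, latticeTerm z s p

theorem latticeTerm_zero (z : ℍ) {s : ℂ} (hs : s ≠ 0) : latticeTerm z s 0 = 0 := by
  simp [latticeTerm, hs]

theorem latticeTerm_neg (z : ℍ) (s : ℂ) (p : ℤ × ℤ) :
    latticeTerm z s (-p) = latticeTerm z s p := by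
  have : ((-p).1 * z + (-p).2 : ℂ) = -(p.1 * z + p.2) := by simp; ring
  rw [latticeTerm, this, Complex.normSq_neg, latticeTerm]

theorem summable_latticeTerm (z : ℍ) {s : ℂ} (hs : 1 < s.re) : Summable (latticeTerm z s) := by
  have h0 := EisensteinSeries.summable_one_div_norm_rpow (k := 2 * s.re) (by linarith)
  rw [← (finTwoArrowEquiv ℤ).symm.summable_iff] at h0
  refine Summable.of_norm_bounded
    (h0.mul_left (z.im ^ s.re * EisensteinSeries.r z ^ (-(2 * s.re)))) fun p => ?_
  have h1 := EisensteinSeries.summand_bound z (k := 2 * s.re) (by linarith) ![p.1, p.2]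
  have h2 : ‖latticeTerm z s p‖ = z.im ^ s.re * ‖(p.1 * z + p.2 : ℂ)‖ ^ (-(2 * s.re)) := by
    rw [latticeTerm, Complex.norm_cpow_eq_rpow_re_of_nonneg
      (div_nonneg z.im_pos.le (Complex.normSq_nonneg _)) (by linarith),
      Real.div_rpow z.im_pos.le (Complex.normSq_nonneg _), Complex.normSq_eq_norm_sq,
      ← Real.rpow_natCast, ← Real.rpow_mul (norm_nonneg _), Real.rpow_neg (norm_nonneg _),
      div_eq_mul_inv, Nat.cast_ofNat]
  rw [h2, mul_assoc]
  gcongr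
  simpa [finTwoArrowEquiv] using h1

theorem tsum_int_of_even {f : ℤ → ℂ} (hf : Summable f) (heven : ∀ n, f (-n) = f n) :
    ∑' n, f n = f 0 + 2 * ∑' n : ℕ, f (n + 1) := by
  have h1 : Summable fun n : ℕ => f (n + 1) :=
    hf.comp_injective (i := fun n : ℕ => ((n : ℤ) + 1)) fun a b h => by simpa using h
  have h2 : (fun n : ℕ => f (-(n + 1))) = fun n : ℕ => f (n + 1) := funext fun n => heven _
  rw [tsum_of_add_one_of_neg_add_one h1 (by rw [h2]; exact h1), h2]
  ring

/-- This holds for `y = 0` as well: both sides vanish unless `s = 0`. -/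
theorem ofReal_div_cpow {x y : ℝ} (hx : 0 ≤ x) (hy : 0 ≤ y) (s : ℂ) :
    ((x / y : ℝ) : ℂ) ^ s = (x : ℂ) ^ s * (y : ℂ) ^ (-s) := by
  rw [div_eq_mul_inv, Complex.ofReal_mul, Complex.mul_cpow_ofReal_nonneg hx (inv_nonneg.mpr hy),
    Complex.ofReal_inv, Complex.inv_cpow _ _ (by
      rw [Complex.arg_ofReal_of_nonneg hy]; exact Real.pi_pos.ne), Complex.cpow_neg]

/-- The sum over the lattice, row by row. -/
theorem latticeSum_eq (z : ℍ) {s : ℂ} (hs : 1 < s.re) :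
    latticeSum z s = 2 * (z.im : ℂ) ^ s *
      (riemannZeta (2 * s) + ∑' m : ℕ, lineSum ((m + 1) * z) s) := by
  have hsum := summable_latticeTerm z hs
  have hs0 : s ≠ 0 := fun h => by simp [h] at hs; linarith
  have hrow : ∀ m : ℤ, Summable fun n => latticeTerm z s (m, n) := fun m => hsum.prod_factor m
  have heven : ∀ m : ℤ, ∑' n, latticeTerm z s (-m, n) = ∑' n, latticeTerm z s (m, n) := by
    intro m
    rw [← (Equiv.neg ℤ).tsum_eq fun n => latticeTerm z s (-m, n)]
    exact tsum_congr fun n => latticeTerm_neg z s (m, n)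
  have hzero : ∑' n, latticeTerm z s (0, n) = 2 * ((z.im : ℂ) ^ s * riemannZeta (2 * s)) := by
    rw [tsum_int_of_even (hrow 0) fun n => by simpa using latticeTerm_neg z s (0, n),
      show latticeTerm z s (0, 0) = 0 from latticeTerm_zero z hs0, zero_add,
      zeta_eq_tsum_one_div_nat_add_one_cpow (by simp; linarith)]
    congr 1
    rw [← tsum_mul_left]
    refine tsum_congr fun n => ?_
    rw [latticeTerm, ofReal_div_cpow z.im_pos.le (Complex.normSq_nonneg _)]
    congr 1
    have h : Complex.normSq (((0, (n : ℤ) + 1) : ℤ × ℤ).1 * (z : ℂ) + ((0, (n : ℤ) + 1) : ℤ × ℤ).2)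
        = ((n : ℝ) + 1) ^ 2 := by
      have : (((0, (n : ℤ) + 1) : ℤ × ℤ).1 * (z : ℂ) + ((0, (n : ℤ) + 1) : ℤ × ℤ).2) =
          (((n : ℝ) + 1 : ℝ) : ℂ) := by simp
      rw [this, Complex.normSq_ofReal, sq]
    rw [h, ofReal_sq_cpow (by positivity), one_div, mul_neg, Complex.cpow_neg]
    simp
  have hpos : ∀ m : ℕ, ∑' n, latticeTerm z s ((m : ℤ) + 1, n) =
      (z.im : ℂ) ^ s * lineSum ((m + 1) * z) s := by
    intro m
    rw [lineSum, ← tsum_mul_left]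
    refine tsum_congr fun n => ?_
    rw [latticeTerm, ofReal_div_cpow z.im_pos.le (Complex.normSq_nonneg _), lineTerm]
    simp
  -- the rows `m` and `-m` have the same sum
  have htot : latticeSum z s = ∑' m, ∑' n, latticeTerm z s (m, n) := hsum.tsum_prod
  rw [htot, tsum_int_of_even (f := fun m => ∑' n, latticeTerm z s (m, n)) hsum.prod heven, hzero,
    tsum_congr hpos, tsum_mul_left]
  ring

/-- The difference between the sum of `|(m + 1) z + n| ^ (-2 s)` over `n ∈ ℤ` and the
corresponding integral. -/
def lineDefect (z : ℍ) (s : ℂ) (m : ℕ) : ℂ :=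
  lineSum ((m + 1) * z) s - (((m + 1) * z.im : ℝ) : ℂ) ^ (1 - 2 * s) * (Real.sqrt Real.pi : ℂ) *
    Complex.Gamma (s - 1 / 2) / Complex.Gamma s

/-- The part of the completed Epstein zeta function that is holomorphic for `Re s > 1 / 2`. -/
def regularPart (z : ℍ) (s : ℂ) : ℂ :=
  (Real.pi : ℂ) ^ (-s) * Complex.Gamma s * (z.im : ℂ) ^ s *
    (riemannZeta (2 * s) + ∑' m : ℕ, lineDefect z s m)

theorem im_natCast_add_one_mul (z : ℍ) (m : ℕ) :
    (((m : ℂ) + 1) * (z : ℂ)).im = (m + 1) * z.im := by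
  simp

theorem norm_lineDefect_le (z : ℍ) {s : ℂ} (hs : 1 / 2 < s.re) (m : ℕ) :
    ‖lineDefect z s m‖ ≤ 2 * Real.pi * ‖s‖ * ((m + 1) * z.im) ^ (-(2 * s.re)) := by
  have h := norm_lineSum_sub_le (w := ((m : ℂ) + 1) * z) (s := s)
    (by rw [im_natCast_add_one_mul]; have := z.im_pos; positivity) hs
  rwa [im_natCast_add_one_mul] at h

theorem summable_natCast_add_one_mul_rpow {y : ℝ} (hy : 0 < y) {σ : ℝ} (hσ : 1 / 2 < σ) :
    Summable fun m : ℕ => (((m : ℝ) + 1) * y) ^ (-(2 * σ)) := by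
  have h := (summable_nat_add_iff 1).mpr
    (Real.summable_nat_rpow (p := -(2 * σ)).mpr (by linarith))
  refine (h.mul_right (y ^ (-(2 * σ)))).congr fun m => ?_
  rw [Real.mul_rpow (by positivity) hy.le]
  push_cast
  rfl

theorem summable_lineDefect (z : ℍ) {s : ℂ} (hs : 1 / 2 < s.re) : Summable (lineDefect z s) :=
  Summable.of_norm_bounded ((summable_natCast_add_one_mul_rpow z.im_pos hs).mul_left _)
    (norm_lineDefect_le z hs)

theorem differentiableOn_lineDefect (z : ℍ) (m : ℕ) :
    DifferentiableOn ℂ (fun s => lineDefect z s m) {s | 1 / 2 < s.re} := by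
  have hy := z.im_pos
  have hpos : 0 < ((m : ℝ) + 1) * z.im := by positivity
  refine (differentiableOn_lineSum (by rw [im_natCast_add_one_mul]; exact hpos.ne')).sub ?_
  intro s hs
  have hs' : 1 / 2 < s.re := hs
  have h1 : DifferentiableAt ℂ Complex.Gamma s :=
    Complex.differentiableAt_Gamma _ fun n h => by
      have := congrArg Complex.re h
      simp at this
      linarith [(Nat.cast_nonneg n : (0 : ℝ) ≤ n)]
  have h2 : DifferentiableAt ℂ (fun s => Complex.Gamma (s - 1 / 2)) s := by
    refine DifferentiableAt.comp s (Complex.differentiableAt_Gamma _ fun n h => ?_) (by fun_prop)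
    have := congrArg Complex.re h
    simp at this
    linarith [(Nat.cast_nonneg n : (0 : ℝ) ≤ n)]
  have h3 : DifferentiableAt ℂ (fun s => (((m + 1) * z.im : ℝ) : ℂ) ^ (1 - 2 * s)) s :=
    DifferentiableAt.const_cpow (by fun_prop) (Or.inl (Complex.ofReal_ne_zero.mpr hpos.ne'))
  exact (((h3.mul_const _).mul h2).div h1
    (Complex.Gamma_ne_zero_of_re_pos (by linarith))).differentiableWithinAt

theorem differentiableAt_tsum_lineDefect (z : ℍ) {s₀ : ℂ} (hs₀ : 1 / 2 < s₀.re) :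
    DifferentiableAt ℂ (fun s => ∑' m, lineDefect z s m) s₀ := by
  obtain ⟨a, ha, ha'⟩ := exists_between hs₀
  have hopen : IsOpen ({s : ℂ | a < s.re ∧ s.re < s₀.re + 1} ∩ Metric.ball s₀ 1) :=
    ((isOpen_lt continuous_const Complex.continuous_re).inter
      (isOpen_lt Complex.continuous_re continuous_const)).inter Metric.isOpen_ball
  refine DifferentiableOn.differentiableAt (s := {s : ℂ | a < s.re ∧ s.re < s₀.re + 1} ∩
    Metric.ball s₀ 1) ?_ (hopen.mem_nhds ⟨⟨ha', by linarith⟩, Metric.mem_ball_self one_pos⟩)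
  refine Complex.differentiableOn_tsum_of_summable_norm
    (u := fun m : ℕ => 2 * Real.pi * (‖s₀‖ + 1) * ((((m : ℝ) + 1) * z.im) ^ (-(2 * a)) +
      (((m : ℝ) + 1) * z.im) ^ (-(2 * (s₀.re + 1)))))
    (((summable_natCast_add_one_mul_rpow z.im_pos ha).add
      (summable_natCast_add_one_mul_rpow z.im_pos (by linarith))).mul_left _)
    (fun m => (differentiableOn_lineDefect z m).mono fun s hs => ha.trans hs.1.1) hopen ?_
  rintro m s ⟨⟨h1, h2⟩, h3⟩
  refine (norm_lineDefect_le z (ha.trans h1) m).trans ?_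
  have hy := z.im_pos
  have hx : 0 < ((m : ℝ) + 1) * z.im := by positivity
  have h4 : ‖s‖ ≤ ‖s₀‖ + 1 := by
    have := norm_le_norm_add_norm_sub' s s₀
    rw [Metric.mem_ball, dist_eq_norm] at h3
    linarith
  gcongr
  -- the first summand bounds the term if the base is at least `1`, the second otherwise
  rcases le_total 1 (((m : ℝ) + 1) * z.im) with h | h
  · exact (Real.rpow_le_rpow_of_exponent_le h (by linarith)).trans
      (le_add_of_nonneg_right (by positivity))
  · exact (Real.rpow_le_rpow_of_exponent_ge hx h (by linarith)).trans
      (le_add_of_nonneg_left (by positivity))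

theorem differentiableAt_regularPart (z : ℍ) {s : ℂ} (hs : 1 / 2 < s.re) :
    DifferentiableAt ℂ (regularPart z) s := by
  have h1 : DifferentiableAt ℂ Complex.Gamma s :=
    Complex.differentiableAt_Gamma _ fun n h => by
      have := congrArg Complex.re h
      simp at this
      linarith [(Nat.cast_nonneg n : (0 : ℝ) ≤ n)]
  have h2 : DifferentiableAt ℂ (fun s : ℂ => (Real.pi : ℂ) ^ (-s)) s :=
    DifferentiableAt.const_cpow (by fun_prop) (Or.inl (by simp [Real.pi_ne_zero]))
  have h3 : DifferentiableAt ℂ (fun s : ℂ => (z.im : ℂ) ^ s) s :=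
    DifferentiableAt.const_cpow (by fun_prop) (Or.inl (by simp [z.im_ne_zero]))
  have h4 : DifferentiableAt ℂ (fun s : ℂ => riemannZeta (2 * s)) s := by
    refine DifferentiableAt.comp s (differentiableAt_riemannZeta fun h => ?_) (by fun_prop)
    have := congrArg Complex.re h
    simp at this
    linarith
  exact ((h2.mul h1).mul h3).mul (h4.add (differentiableAt_tsum_lineDefect z hs))

/-- The completed Epstein zeta function is the sum of its regular part and the contribution of the
integrals over the rows, which carries the pole at `s = 1`. -/
theorem completed_latticeSum_eq (z : ℍ) {s : ℂ} (hs : 1 < s.re) :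
    (Real.pi : ℂ) ^ (-s) * Complex.Gamma s * latticeSum z s / 2 =
      regularPart z s + zetaStar (2 * s - 1) * (z.im : ℂ) ^ (1 - s) := by
  have hy : (z.im : ℂ) ≠ 0 := Complex.ofReal_ne_zero.mpr z.im_ne_zero
  have hpi : (Real.pi : ℂ) ≠ 0 := Complex.ofReal_ne_zero.mpr Real.pi_ne_zero
  have hG : Complex.Gamma s ≠ 0 := Complex.Gamma_ne_zero_of_re_pos (by linarith)
  set c : ℂ := (z.im : ℂ) ^ (1 - 2 * s) * (Real.sqrt Real.pi : ℂ) *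
    Complex.Gamma (s - 1 / 2) / Complex.Gamma s with hc
  have h1 : ∀ m : ℕ, lineSum ((m + 1) * z) s =
      lineDefect z s m + c * (1 / ((m : ℂ) + 1) ^ (2 * s - 1)) := by
    intro m
    have h : (((m + 1) * z.im : ℝ) : ℂ) ^ (1 - 2 * s) =
        (z.im : ℂ) ^ (1 - 2 * s) * (1 / ((m : ℂ) + 1) ^ (2 * s - 1)) := by
      rw [Complex.ofReal_mul, Complex.mul_cpow_ofReal_nonneg (by positivity) z.im_pos.le, one_div,
        ← Complex.cpow_neg, neg_sub, mul_comm]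
      simp
    rw [lineDefect, h, hc]
    ring
  have hre : 1 < (2 * s - 1).re := by simp; linarith
  have h2 : Summable fun m : ℕ => (1 : ℂ) / ((m : ℂ) + 1) ^ (2 * s - 1) := by
    have := (summable_nat_add_iff 1).mpr (Complex.summable_one_div_nat_cpow.mpr hre)
    simpa using this
  have h3 : ∑' m : ℕ, lineSum ((m + 1) * z) s =
      ∑' m, lineDefect z s m + c * riemannZeta (2 * s - 1) := by
    rw [zeta_eq_tsum_one_div_nat_add_one_cpow hre, ← tsum_mul_left,
      ← (summable_lineDefect z (by linarith)).tsum_add (h2.mul_left c)]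
    exact tsum_congr h1
  have h4 : (Real.pi : ℂ) ^ (-(2 * s - 1) / 2) =
      (Real.pi : ℂ) ^ (-s) * (Real.sqrt Real.pi : ℂ) := by
    rw [Real.sqrt_eq_rpow, Complex.ofReal_cpow Real.pi_pos.le, ← Complex.cpow_add _ _ hpi]
    congr 1
    push_cast
    ring
  have h5 : (z.im : ℂ) ^ (1 - s) = (z.im : ℂ) ^ s * (z.im : ℂ) ^ (1 - 2 * s) := by
    rw [← Complex.cpow_add _ _ hy]
    congr 1
    ring
  rw [latticeSum_eq z hs, h3, regularPart, zetaStar, h4, h5, hc,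
    show (2 * s - 1) / 2 = s - 1 / 2 by ring]
  field_simp
  ring

/-- The value of the regular part at `s = 1` is the logarithm of the product for `Δ`. -/
theorem regularPart_one (z : ℍ) :
    regularPart z 1 = ((-(1 / 12) * Real.log ‖ModularForm.discriminant z‖ : ℝ) : ℂ) := by
  have hD := log_norm_discriminant z
  set q : ℂ := Complex.exp (2 * Real.pi * Complex.I * z)
  have hq : ‖q‖ < 1 := norm_exp_two_pi_I_lt_one z
  have hy := z.im_pos
  have h1 : ∀ m : ℕ, lineDefect z 1 m =
      ((2 * Real.pi / z.im * ((∑' k : ℕ, (q ^ (m + 1)) ^ (k + 1)).re / (m + 1)) : ℝ) : ℂ) := by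
    intro m
    have hpos : 0 < ((m : ℝ) + 1) * z.im := by positivity
    have him := im_natCast_add_one_mul z m
    have h := im_mul_lineSum_one ⟨((m : ℂ) + 1) * z, by rw [him]; exact hpos⟩
    have hexp : Complex.exp (2 * Real.pi * Complex.I * (((m : ℂ) + 1) * z)) = q ^ (m + 1) := by
      rw [← Complex.exp_nat_mul]
      congr 1
      push_cast
      ring
    have him' : (⟨((m : ℂ) + 1) * z, by rw [him]; exact hpos⟩ : ℍ).im = (m + 1) * z.im := him
    rw [him'] at h
    simp only [hexp] at h
    have hx : (((m + 1) * z.im : ℝ) : ℂ) ≠ 0 := Complex.ofReal_ne_zero.mpr hpos.ne'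
    have hpp : (Real.sqrt Real.pi : ℂ) * Complex.Gamma (1 / 2) = (Real.pi : ℂ) := by
      rw [Complex.Gamma_one_half_eq, Real.sqrt_eq_rpow, Complex.ofReal_cpow Real.pi_pos.le,
        ← Complex.cpow_add _ _ (by simp [Real.pi_ne_zero])]
      norm_num
    have h2 : lineDefect z 1 m = lineSum ((m + 1) * z) 1 - (Real.pi : ℂ) /
        (((m + 1) * z.im : ℝ) : ℂ) := by
      rw [lineDefect, show (1 - 2 * 1 : ℂ) = -1 by norm_num, Complex.cpow_neg_one,
        show (1 - 1 / 2 : ℂ) = 1 / 2 by norm_num, mul_assoc, hpp, Complex.Gamma_one]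
      ring
    have h3 : lineSum ((m + 1) * z) 1 = ((Real.pi + 2 * Real.pi *
        (∑' k : ℕ, (q ^ (m + 1)) ^ (k + 1)).re : ℝ) : ℂ) / (((m + 1) * z.im : ℝ) : ℂ) :=
      eq_div_of_mul_eq hx (by rw [mul_comm]; exact h)
    rw [h2, h3, ← Complex.ofReal_div, ← Complex.ofReal_div, ← Complex.ofReal_sub]
    congr 1
    field_simp
    ring
  have h2 : ∑' m, lineDefect z 1 m = ((2 * Real.pi / z.im *
      -∑' k : ℕ, Real.log ‖1 - q ^ (k + 1)‖ : ℝ) : ℂ) := by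
    rw [tsum_congr h1, ← Complex.ofReal_tsum, tsum_mul_left, tsum_re_tsum_pow_div hq]
  have h3 : Complex.Gamma 1 = 1 := Complex.Gamma_one
  rw [regularPart, h2, h3, mul_one, mul_one, riemannZeta_two, hD, Complex.cpow_neg_one,
    Complex.cpow_one]
  have hpi : (Real.pi : ℂ) ≠ 0 := Complex.ofReal_ne_zero.mpr Real.pi_ne_zero
  have hyc : (z.im : ℂ) ≠ 0 := Complex.ofReal_ne_zero.mpr z.im_ne_zero
  push_cast
  field_simp
  ring

/-! ### Cosets of `Γ_∞` and primitive vectors -/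

/-- The bottom rows of the elements of `Γ₀(N)`. -/
def primitivePairs (N : ℕ) : Set (ℤ × ℤ) := {p | IsCoprime p.1 p.2 ∧ (N : ℤ) ∣ p.1}

/-- Plus or minus the bottom row of the chosen representative of a class in `Γ_∞ \ Γ₀(N)`. -/
def signedRow (N : ℕ) (x : Cosets N × ℤˣ) : ℤ × ℤ :=
  ((x.2 : ℤ) * (x.1.out : SL(2, ℤ)) 1 0, (x.2 : ℤ) * (x.1.out : SL(2, ℤ)) 1 1)

theorem mul_inv_apply_one_zero (g h : SL(2, ℤ)) :
    (g * h⁻¹) 1 0 = g 1 0 * h 1 1 - g 1 1 * h 1 0 := by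
  rw [Matrix.SpecialLinearGroup.coe_mul, Matrix.mul_apply, Fin.sum_univ_two,
    Matrix.SpecialLinearGroup.SL2_inv_expl]
  simp
  ring

theorem signedRow_injective (N : ℕ) : Function.Injective (signedRow N) := by
  rintro ⟨q, u⟩ ⟨q', u'⟩ h
  simp only [signedRow, Prod.mk.injEq] at h
  obtain ⟨h1, h2⟩ := h
  have hq : q = q' := by
    rw [← Quotient.out_eq q, ← Quotient.out_eq q']
    refine Quotient.sound (QuotientGroup.rightRel_apply.mpr ?_)
    have h3 : ((q'.out : SL(2, ℤ)) * (q.out : SL(2, ℤ))⁻¹) 1 0 = 0 := by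
      rw [mul_inv_apply_one_zero]
      refine (mul_eq_zero.mp (?_ : (u' : ℤ) * _ = 0)).resolve_left u'.ne_zero
      linear_combination (q.out : SL(2, ℤ)) 1 0 * h2 - (q.out : SL(2, ℤ)) 1 1 * h1
    exact h3
  subst hq
  have hcop := ModularGroup.bottom_row_coprime (q.out : SL(2, ℤ))
  have hu : (u : ℤ) = u' := by
    obtain ⟨a, b, hab⟩ := hcop
    linear_combination a * h1 + b * h2 + ((u' : ℤ) - u) * hab
  rw [Units.ext hu]

theorem range_signedRow (N : ℕ) : Set.range (signedRow N) = primitivePairs N := by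
  ext p
  constructor
  · rintro ⟨⟨q, u⟩, rfl⟩
    have hcop := ModularGroup.bottom_row_coprime (q.out : SL(2, ℤ))
    refine ⟨?_, ?_⟩
    · exact (isCoprime_mul_unit_left u.isUnit _ _).mpr hcop
    · have := CongruenceSubgroup.Gamma0_mem.mp q.out.2
      exact Dvd.dvd.mul_left ((ZMod.intCast_zmod_eq_zero_iff_dvd _ N).mp this) _
  · rintro ⟨hcop, hdvd⟩
    obtain ⟨g, -, hg⟩ := ModularGroup.bottom_row_surj (R := ℤ)
      (show (![p.1, p.2] : Fin 2 → ℤ) ∈ {cd : Fin 2 → ℤ | IsCoprime (cd 0) (cd 1)} by simpa)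
    have hg0 : g 1 0 = p.1 := by simpa using congrFun hg 0
    have hg1 : g 1 1 = p.2 := by simpa using congrFun hg 1
    have hmem : g ∈ CongruenceSubgroup.Gamma0 N := by
      rw [CongruenceSubgroup.Gamma0_mem, hg0]
      exact (ZMod.intCast_zmod_eq_zero_iff_dvd _ N).mpr hdvd
    set q : Cosets N := Quotient.mk _ (⟨g, hmem⟩ : CongruenceSubgroup.Gamma0 N)
    have hrel : ((q.out : SL(2, ℤ)) * g⁻¹) 1 0 = 0 :=
      QuotientGroup.rightRel_apply.mp (Quotient.exact (Quotient.out_eq q).symm)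
    set h : SL(2, ℤ) := (q.out : SL(2, ℤ)) * g⁻¹ with hh
    have hout : (q.out : SL(2, ℤ)) = h * g := by rw [hh, inv_mul_cancel_right]
    have hdet : h 0 0 * h 1 1 = 1 := by
      have h3 := Matrix.SpecialLinearGroup.det_coe h
      rw [Matrix.det_fin_two, hrel] at h3
      simpa using h3
    have hunit : IsUnit (h 1 1) := IsUnit.of_mul_eq_one_right _ hdet
    obtain ⟨u, hu⟩ := hunit
    have huu : (u : ℤ) * u = 1 := by
      rcases Int.units_eq_one_or u with rfl | rfl <;> simp
    have hrow : ∀ j, (q.out : SL(2, ℤ)) 1 j = u * g 1 j := by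
      intro j
      rw [hout, Matrix.SpecialLinearGroup.coe_mul, Matrix.mul_apply, Fin.sum_univ_two, hrel, ← hu]
      simp
    refine ⟨(q, u), ?_⟩
    simp only [signedRow, hrow, ← mul_assoc, huu, one_mul, hg0, hg1]

theorem latticeTerm_signedRow (N : ℕ) (z : ℍ) (s : ℂ) (x : Cosets N × ℤˣ) :
    latticeTerm z s (signedRow N x) = eisensteinTerm N z s x.1 := by
  obtain ⟨q, u⟩ := x
  have h1 : latticeTerm z s (signedRow N (q, u)) = latticeTerm z s (signedRow N (q, 1)) := by
    rcases Int.units_eq_one_or u with rfl | rfl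
    · rfl
    · rw [← latticeTerm_neg]
      simp [signedRow]
  have h2 : cosetIm N z q = ((q.out : SL(2, ℤ)) • z).im := by
    conv_lhs => rw [← Quotient.out_eq q]
    rfl
  rw [h1, eisensteinTerm, h2, ModularGroup.im_smul_eq_div_normSq, ModularGroup.denom_apply]
  simp [latticeTerm, signedRow]

theorem summable_eisensteinTerm (N : ℕ) (z : ℍ) {s : ℂ} (hs : 1 < s.re) :
    Summable (eisensteinTerm N z s) := by
  have h : Function.Injective fun q : Cosets N => signedRow N (q, 1) :=
    fun a b hab => congrArg Prod.fst (signedRow_injective N hab)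
  exact ((summable_latticeTerm z hs).comp_injective h).congr
    fun q => latticeTerm_signedRow N z s (q, 1)

/-- Each class in `Γ_∞ \ Γ₀(N)` accounts for two primitive vectors, which differ by the sign. -/
theorem two_mul_eisenstein (N : ℕ) (z : ℍ) {s : ℂ} (hs : 1 < s.re) :
    2 * eisenstein N z s = ∑' p : primitivePairs N, latticeTerm z s p := by
  have h1 : ∑' p : primitivePairs N, latticeTerm z s p =
      ∑' x : Cosets N × ℤˣ, latticeTerm z s (signedRow N x) := by
    rw [← range_signedRow, tsum_range (f := latticeTerm z s) (signedRow_injective N)]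
  have h2 : Summable fun x : Cosets N × ℤˣ => latticeTerm z s (signedRow N x) :=
    (summable_latticeTerm z hs).comp_injective (signedRow_injective N)
  rw [h1, h2.tsum_prod, eisenstein, ← tsum_mul_left]
  refine tsum_congr fun q => ?_
  simp only [latticeTerm_signedRow, tsum_fintype, Finset.sum_const, Finset.card_univ,
    Fintype.card_units_int]
  simp

/-! ### Removing the coprimality conditions -/

/-- The positive integers coprime to `N`. -/
def coprimeTo (N : ℕ) : Set ℕ := {n | n ≠ 0 ∧ n.Coprime N}

/-- The pairs `(c, d)` with `N ∣ c` and `d` coprime to `N`. -/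
def rowsCoprime (N : ℕ) : Set (ℤ × ℤ) := {p | (N : ℤ) ∣ p.1 ∧ p.2.gcd N = 1}

theorem zetaAway_eq_tsum (N : ℕ) [NeZero N] {s : ℂ} (hs : 1 < s.re) :
    Summable (fun n : coprimeTo N => ((n : ℕ) : ℂ) ^ (-s)) ∧
      zetaAway N s = ∑' n : coprimeTo N, ((n : ℕ) : ℂ) ^ (-s) := by
  have hs1 : s ≠ 1 := fun h => by simp [h] at hs
  have hsum := DirichletCharacter.LSeriesSummable_of_one_lt_re (1 : DirichletCharacter ℂ N) hs
  have hterm : LSeries.term (fun n => (1 : DirichletCharacter ℂ N) n) s =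
      (coprimeTo N).indicator fun n : ℕ => (n : ℂ) ^ (-s) := by
    funext n
    by_cases hn : n = 0
    · subst hn
      simp [coprimeTo]
    · rw [LSeries.term_of_ne_zero hn]
      by_cases hc : n.Coprime N
      · rw [Set.indicator_of_mem (show n ∈ coprimeTo N from ⟨hn, hc⟩),
          MulChar.one_apply ((ZMod.isUnit_iff_coprime n N).mpr hc), Complex.cpow_neg, one_div]
      · rw [Set.indicator_of_notMem (fun h => hc h.2),
          MulChar.map_nonunit _ fun h => hc ((ZMod.isUnit_iff_coprime n N).mp h), zero_div]
  refine ⟨?_, ?_⟩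
  · have h2 : Summable ((coprimeTo N).indicator fun n : ℕ => (n : ℂ) ^ (-s)) := by
      rw [← hterm]; exact hsum
    exact summable_subtype_iff_indicator.mpr h2
  · rw [tsum_subtype (coprimeTo N) fun n : ℕ => (n : ℂ) ^ (-s), ← hterm, zetaAway, mul_comm,
      ← DirichletCharacter.LFunctionTrivChar_eq_mul_riemannZeta hs1,
      DirichletCharacter.LFunctionTrivChar, DirichletCharacter.LFunction_eq_LSeries _ hs, LSeries]

/-- A nonzero vector in `rowsCoprime N` is a unique multiple of a primitive one. -/
theorem zetaAway_mul_tsum_primitivePairs (N : ℕ) [NeZero N] (z : ℍ) {s : ℂ} (hs : 1 < s.re) :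
    zetaAway N (2 * s) * ∑' p : primitivePairs N, latticeTerm z s p =
      ∑' p : rowsCoprime N, latticeTerm z s p := by
  have hs0 : s ≠ 0 := fun h => by simp [h] at hs; linarith
  obtain ⟨h1, h2⟩ := zetaAway_eq_tsum N (s := 2 * s) (by simp; linarith)
  have h3 : Summable fun p : primitivePairs N => latticeTerm z s p :=
    (summable_latticeTerm z hs).subtype _
  rw [h2, tsum_mul_tsum_of_summable_norm h1.norm h3.norm, tsum_subtype (rowsCoprime N)]
  set φ : coprimeTo N × primitivePairs N → ℤ × ℤ :=
    fun x => (((x.1 : ℕ) : ℤ) * (x.2 : ℤ × ℤ).1, ((x.1 : ℕ) : ℤ) * (x.2 : ℤ × ℤ).2)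
  have hgcd : ∀ x, (φ x).1.gcd (φ x).2 = x.1 := by
    rintro ⟨⟨n, hn⟩, ⟨p, hp⟩⟩
    simp only [φ]
    rw [Int.gcd_mul_left, Int.isCoprime_iff_gcd_eq_one.mp hp.1]
    simp
  have hinj : Function.Injective φ := by
    intro x y hxy
    have hn : (x.1 : ℕ) = y.1 := by rw [← hgcd x, hxy, hgcd y]
    have hn0 : ((y.1 : ℕ) : ℤ) ≠ 0 := Nat.cast_ne_zero.mpr y.1.2.1
    simp only [φ, Prod.mk.injEq, hn] at hxy
    refine Prod.ext (Subtype.ext hn) (Subtype.ext (Prod.ext ?_ ?_))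
    · exact mul_left_cancel₀ hn0 hxy.1
    · exact mul_left_cancel₀ hn0 hxy.2
  have hmem : ∀ x, φ x ∈ rowsCoprime N := by
    rintro ⟨⟨n, hn⟩, ⟨p, hp⟩⟩
    refine ⟨Dvd.dvd.mul_left hp.2 _, ?_⟩
    have hc : IsCoprime p.2 (N : ℤ) := (hp.1.of_isCoprime_of_dvd_left hp.2).symm
    have hc' : IsCoprime (n : ℤ) (N : ℤ) := Nat.isCoprime_iff_coprime.mpr hn.2
    exact Int.isCoprime_iff_gcd_eq_one.mp (hc'.mul_left hc)
  -- the zero vector lies in `rowsCoprime 1`, but its term vanishes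
  have hsupp : Function.support ((rowsCoprime N).indicator (latticeTerm z s)) ⊆ Set.range φ := by
    intro p hp
    have hpN : p ∈ rowsCoprime N := Set.mem_of_indicator_ne_zero hp
    have hp0 : p ≠ 0 := by
      rintro rfl
      refine hp ?_
      rw [Set.indicator_of_mem hpN, latticeTerm_zero z hs0]
    set g : ℕ := p.1.gcd p.2
    have hg0 : g ≠ 0 := fun h => hp0 (Prod.ext (Int.gcd_eq_zero_iff.mp h).1
      (Int.gcd_eq_zero_iff.mp h).2)
    obtain ⟨c, hc⟩ : (g : ℤ) ∣ p.1 := Int.gcd_dvd_left ..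
    obtain ⟨d, hd⟩ : (g : ℤ) ∣ p.2 := Int.gcd_dvd_right ..
    have hgN : IsCoprime (g : ℤ) (N : ℤ) :=
      (Int.isCoprime_iff_gcd_eq_one.mpr hpN.2).of_isCoprime_of_dvd_left ⟨d, hd⟩
    have hcd : IsCoprime c d := by
      rw [Int.isCoprime_iff_gcd_eq_one]
      have h4 : p.1.gcd p.2 = g * c.gcd d := by
        conv_lhs => rw [hc, hd, Int.gcd_mul_left]
        simp
      exact Nat.eq_of_mul_eq_mul_left (Nat.pos_of_ne_zero hg0) (by rw [← h4, mul_one])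
    have hNc : (N : ℤ) ∣ c := hgN.symm.dvd_of_dvd_mul_left (hc ▸ hpN.1)
    exact ⟨(⟨g, hg0, Nat.isCoprime_iff_coprime.mp hgN⟩, ⟨(c, d), hcd, hNc⟩),
      Prod.ext hc.symm hd.symm⟩
  rw [← hinj.tsum_eq hsupp]
  refine tsum_congr fun x => ?_
  rw [Set.indicator_of_mem (hmem x)]
  simp only [latticeTerm, φ]
  have hnorm : Complex.normSq (((((x.1 : ℕ) : ℤ) * (x.2 : ℤ × ℤ).1 : ℤ) : ℂ) * z +
      ((((x.1 : ℕ) : ℤ) * (x.2 : ℤ × ℤ).2 : ℤ) : ℂ)) = ((x.1 : ℕ) : ℝ) ^ 2 *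
        Complex.normSq ((x.2 : ℤ × ℤ).1 * z + (x.2 : ℤ × ℤ).2) := by
    rw [sq, ← Complex.normSq_natCast, ← Complex.normSq_mul]
    congr 1
    push_cast
    ring
  have hx0 : (0 : ℝ) < ((x.1 : ℕ) : ℝ) := Nat.cast_pos.mpr (Nat.pos_of_ne_zero x.1.2.1)
  rw [hnorm, mul_comm (_ ^ 2), ← div_div,
    ofReal_div_cpow (div_nonneg z.im_pos.le (Complex.normSq_nonneg _)) (by positivity),
    ofReal_sq_cpow hx0, mul_comm, mul_neg]
  simp

theorem sum_moebius_divisors_dvd (N : ℕ) (hN : N ≠ 0) (d : ℤ) :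
    ∑ e ∈ N.divisors, (if (e : ℤ) ∣ d then (ArithmeticFunction.moebius e : ℤ) else 0) =
      if d.gcd N = 1 then 1 else 0 := by
  have hg : d.gcd N ≠ 0 := fun h => hN (by exact_mod_cast (Int.gcd_eq_zero_iff.mp h).2)
  have h := congrArg (fun f : ArithmeticFunction ℤ => f (d.gcd N))
    ArithmeticFunction.coe_zeta_mul_moebius
  simp only [ArithmeticFunction.coe_zeta_mul_apply, ArithmeticFunction.one_apply] at h
  rw [← h, ← Finset.sum_filter]
  refine Finset.sum_congr ?_ fun _ _ => rfl
  ext e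
  simp only [Finset.mem_filter, Nat.mem_divisors]
  constructor
  · rintro ⟨⟨h1, -⟩, h2⟩
    exact ⟨Int.dvd_gcd h2 (Int.natCast_dvd_natCast.mpr h1), hg⟩
  · rintro ⟨h1, -⟩
    have h2 : (e : ℤ) ∣ (d.gcd N : ℤ) := Int.natCast_dvd_natCast.mpr h1
    exact ⟨⟨Int.natCast_dvd_natCast.mp (h2.trans (Int.gcd_dvd_right ..)), hN⟩,
      h2.trans (Int.gcd_dvd_left ..)⟩

/-- The point `t z`, for an integer `t ≥ 1`. -/
def scaled (t : ℕ) (z : ℍ) : ℍ := UpperHalfPlane.ofComplex ((t : ℂ) * (z : ℂ))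

theorem coe_scaled {t : ℕ} (ht : t ≠ 0) (z : ℍ) : (scaled t z : ℂ) = t * z := by
  rw [scaled, UpperHalfPlane.ofComplex_apply_of_im_pos]
  simpa using mul_pos (Nat.cast_pos.mpr (Nat.pos_of_ne_zero ht)) z.im_pos

theorem im_scaled {t : ℕ} (ht : t ≠ 0) (z : ℍ) : (scaled t z).im = t * z.im := by
  rw [← UpperHalfPlane.coe_im, coe_scaled ht]
  simp

/-- With `N = e t`, the vector `(N m, e n)` of the lattice of `z` is `e` times the vector `(m, n)`
of the lattice of `t z`. -/
theorem latticeTerm_mul_mul {e t : ℕ} (he : e ≠ 0) (ht : t ≠ 0) (z : ℍ) (s : ℂ) (p : ℤ × ℤ) :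
    latticeTerm z s ((e * t : ℕ) * p.1, e * p.2) =
      ((e * t : ℕ) : ℂ) ^ (-s) * (e : ℂ) ^ (-s) * latticeTerm (scaled t z) s p := by
  have hnorm : Complex.normSq (((((e * t : ℕ) : ℤ) * p.1 : ℤ) : ℂ) * z + (((e : ℤ) * p.2 : ℤ) : ℂ))
      = (e : ℝ) ^ 2 * Complex.normSq (p.1 * (scaled t z : ℂ) + p.2) := by
    rw [sq, ← Complex.normSq_natCast, ← Complex.normSq_mul, coe_scaled ht]
    congr 1
    push_cast
    ring
  have he' : (e : ℝ) ≠ 0 := Nat.cast_ne_zero.mpr he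
  have ht' : (t : ℝ) ≠ 0 := Nat.cast_ne_zero.mpr ht
  simp only [latticeTerm]
  rw [hnorm, im_scaled ht]
  have h1 : z.im / ((e : ℝ) ^ 2 * Complex.normSq (p.1 * (scaled t z : ℂ) + p.2)) =
      (t * z.im / Complex.normSq (p.1 * (scaled t z : ℂ) + p.2)) / (((e * t * e : ℕ) : ℝ)) := by
    push_cast
    field_simp
  have h2 : (0 : ℝ) ≤ t * z.im / Complex.normSq (p.1 * (scaled t z : ℂ) + p.2) :=
    div_nonneg (mul_nonneg (Nat.cast_nonneg _) z.im_pos.le) (Complex.normSq_nonneg _)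
  rw [h1, ofReal_div_cpow h2 (Nat.cast_nonneg _), Complex.ofReal_natCast, Nat.cast_mul (e * t) e,
    Complex.natCast_mul_natCast_cpow, mul_comm]

/-- Möbius inversion over the divisors of `N` expresses the sum over `rowsCoprime N` through full
lattices. -/
theorem tsum_rowsCoprime (N : ℕ) (hN : N ≠ 0) (z : ℍ) {s : ℂ} (hs : 1 < s.re) :
    ∑' p : rowsCoprime N, latticeTerm z s p = ∑ t ∈ N.divisors,
      (ArithmeticFunction.moebius (N / t) : ℂ) *
        ((N : ℂ) ^ (-s) * ((N / t : ℕ) : ℂ) ^ (-s) * latticeSum (scaled t z) s) := by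
  have hsum := summable_latticeTerm z hs
  rw [tsum_subtype (rowsCoprime N)]
  set S : ℕ → Set (ℤ × ℤ) := fun e => {p | (N : ℤ) ∣ p.1 ∧ (e : ℤ) ∣ p.2}
  have h1 : ∀ p, (rowsCoprime N).indicator (latticeTerm z s) p = ∑ e ∈ N.divisors,
      (ArithmeticFunction.moebius e : ℂ) * (S e).indicator (latticeTerm z s) p := by
    intro p
    by_cases hp : (N : ℤ) ∣ p.1
    · have h2 : ∀ e, (ArithmeticFunction.moebius e : ℂ) * (S e).indicator (latticeTerm z s) p =
          ((if (e : ℤ) ∣ p.2 then (ArithmeticFunction.moebius e : ℤ) else 0 : ℤ) : ℂ) *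
            latticeTerm z s p := by
        intro e
        by_cases he : (e : ℤ) ∣ p.2
        · rw [Set.indicator_of_mem (show p ∈ S e from ⟨hp, he⟩), if_pos he]
        · rw [Set.indicator_of_notMem (fun h => he h.2), if_neg he]
          simp
      simp_rw [h2]
      rw [← Finset.sum_mul, ← Int.cast_sum, sum_moebius_divisors_dvd N hN]
      by_cases hc : p.2.gcd N = 1
      · rw [Set.indicator_of_mem (show p ∈ rowsCoprime N from ⟨hp, hc⟩), if_pos hc]
        simp
      · rw [Set.indicator_of_notMem (fun h => hc h.2), if_neg hc]
        simp
    · rw [Set.indicator_of_notMem (fun h => hp h.1)]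
      refine (Finset.sum_eq_zero fun e _ => ?_).symm
      rw [Set.indicator_of_notMem (fun h => hp h.1), mul_zero]
  rw [tsum_congr h1, Summable.tsum_finsetSum fun e _ => (hsum.indicator (S e)).mul_left _,
    ← Nat.sum_div_divisors N]
  refine Finset.sum_congr rfl fun t ht => ?_
  obtain ⟨e, rfl⟩ := Nat.dvd_of_mem_divisors ht
  have ht0 : t ≠ 0 := left_ne_zero_of_mul hN
  have he0 : e ≠ 0 := right_ne_zero_of_mul hN
  rw [Nat.mul_div_cancel_left e (Nat.pos_of_ne_zero ht0), tsum_mul_left]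
  congr 1
  set φ : ℤ × ℤ → ℤ × ℤ := fun p => ((e * t : ℕ) * p.1, e * p.2)
  have hinj : Function.Injective φ := by
    intro p p' h
    simp only [φ, Prod.mk.injEq] at h
    refine Prod.ext (mul_left_cancel₀ ?_ h.1) (mul_left_cancel₀ ?_ h.2)
    · exact Nat.cast_ne_zero.mpr (mul_ne_zero he0 ht0)
    · exact Nat.cast_ne_zero.mpr he0
  have hmem : ∀ p, φ p ∈ S e := fun p =>
    ⟨by rw [mul_comm t e]; exact Dvd.intro _ rfl, Dvd.intro _ rfl⟩
  have hsupp : Function.support ((S e).indicator (latticeTerm z s)) ⊆ Set.range φ := by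
    intro p hp
    obtain ⟨⟨a, ha⟩, ⟨b, hb⟩⟩ : p ∈ S e := Set.mem_of_indicator_ne_zero hp
    exact ⟨(a, b), Prod.ext (by rw [ha, mul_comm t e]) hb.symm⟩
  rw [← hinj.tsum_eq hsupp, latticeSum, ← tsum_mul_left]
  refine tsum_congr fun p => ?_
  rw [Set.indicator_of_mem (hmem p), latticeTerm_mul_mul he0 ht0, mul_comm t e]

/-- The normalized Eisenstein series is a combination of completed Epstein zeta functions. -/
theorem normalizedEisenstein_eq (N : ℕ) [NeZero N] (z : ℍ) {s : ℂ} (hs : 1 < s.re) :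
    normalizedEisenstein N z s = ∑ t ∈ N.divisors,
      (ArithmeticFunction.moebius (N / t) : ℂ) * (t : ℂ) ^ s *
        ((Real.pi : ℂ) ^ (-s) * Complex.Gamma s * latticeSum (scaled t z) s / 2) := by
  have hN : N ≠ 0 := NeZero.ne N
  have h1 : zetaAway N (2 * s) * eisenstein N z s =
      (∑' p : rowsCoprime N, latticeTerm z s p) / 2 := by
    rw [← zetaAway_mul_tsum_primitivePairs N z hs, ← two_mul_eisenstein N z hs]
    ring
  rw [normalizedEisenstein, mul_assoc _ (zetaAway N (2 * s)), h1, tsum_rowsCoprime N hN z hs,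
    Finset.sum_div, Finset.mul_sum]
  refine Finset.sum_congr rfl fun t ht => ?_
  obtain ⟨e, rfl⟩ := Nat.dvd_of_mem_divisors ht
  have ht0 : t ≠ 0 := left_ne_zero_of_mul hN
  have he0 : e ≠ 0 := right_ne_zero_of_mul hN
  rw [Nat.mul_div_cancel_left e (Nat.pos_of_ne_zero ht0)]
  have h2 : ((t * e : ℕ) : ℂ) ^ (2 * s) * (((t * e : ℕ) : ℂ) ^ (-s) * (e : ℂ) ^ (-s)) =
      (t : ℂ) ^ s := by
    have hN' : ((t * e : ℕ) : ℂ) ≠ 0 := Nat.cast_ne_zero.mpr hN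
    rw [← mul_assoc, ← Complex.cpow_add _ _ hN', show 2 * s + -s = s by ring, Nat.cast_mul,
      Complex.natCast_mul_natCast_cpow, mul_assoc,
      ← Complex.cpow_add _ _ (Nat.cast_ne_zero.mpr he0), add_neg_cancel, Complex.cpow_zero, mul_one]
  rw [← h2]
  ring

/-! ### The exponents of the generalized Delta function -/

/-- Without coprimality the product is not squarefree, so that its Möbius value is `0`. -/
theorem moebius_mul (m d : ℕ) : ArithmeticFunction.moebius (m * d) =
    if m.Coprime d then ArithmeticFunction.moebius m * ArithmeticFunction.moebius d else 0 := by
  split_ifs with h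
  · exact ArithmeticFunction.isMultiplicative_moebius.map_mul_of_coprime h
  · refine ArithmeticFunction.moebius_eq_zero_of_not_squarefree fun hs => h ?_
    exact (Nat.squarefree_mul_iff.mp hs).1

theorem sum_divisors_moebius_mul {f : ArithmeticFunction ℚ} (hf : f.IsMultiplicative) {n : ℕ}
    (hn : n ≠ 0) : ∑ d ∈ n.divisors, (ArithmeticFunction.moebius d : ℚ) * f d =
      ∏ p ∈ n.primeFactors, (1 - f p) := by
  set P := ∏ p ∈ n.primeFactors, p
  have hP : P ∣ n := Nat.prod_primeFactors_dvd n
  have hP0 : P ≠ 0 := ne_zero_of_dvd_ne_zero hn hP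
  have hPf : P.primeFactors = n.primeFactors :=
    Nat.primeFactors_prod fun p hp => Nat.prime_of_mem_primeFactors hp
  have hPs : Squarefree P := by
    refine Finset.squarefree_prod_of_pairwise_isCoprime (fun p hp q hq hpq => ?_) fun p hp =>
      (Nat.prime_of_mem_primeFactors hp).prime.squarefree
    exact Nat.coprime_iff_isRelPrime.mp ((Nat.coprime_primes (Nat.prime_of_mem_primeFactors hp)
      (Nat.prime_of_mem_primeFactors hq)).mpr hpq)
  rw [← hPf, hf.prodPrimeFactors_one_sub_of_squarefree f hPs]
  refine (Finset.sum_subset (Nat.divisors_subset_of_dvd hn hP) fun d hd hd' => ?_).symm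
  rw [ArithmeticFunction.moebius_eq_zero_of_not_squarefree, Int.cast_zero, zero_mul]
  intro hs
  refine hd' (Nat.mem_divisors.mpr ⟨?_, hP0⟩)
  rw [← Nat.prod_primeFactors_of_squarefree hs]
  exact Finset.prod_dvd_prod_of_subset _ _ _
    (Nat.primeFactors_mono (Nat.dvd_of_mem_divisors hd) hn)

/-- `d ↦ 1 / d` on the integers coprime to `m`, and `0` elsewhere. -/
def invCoprime (m : ℕ) : ArithmeticFunction ℚ :=
  ⟨fun d => if m.Coprime d then (d : ℚ)⁻¹ else 0, by simp⟩

theorem isMultiplicative_invCoprime (m : ℕ) : (invCoprime m).IsMultiplicative := by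
  refine ⟨by simp [invCoprime], fun {a b} _ => ?_⟩
  simp only [invCoprime, ArithmeticFunction.coe_mk, Nat.coprime_mul_iff_right]
  rw [ite_and]
  split_ifs <;> simp [mul_comm]

theorem totient_mul_eq (n m : ℕ) (hn : n ≠ 0) (hm : m ≠ 0) :
    ((n * m).totient : ℚ) = m.totient * n * ∏ p ∈ n.primeFactors, (1 - invCoprime m p) := by
  have h1 : ∏ p ∈ n.primeFactors, (1 - invCoprime m p) =
      ∏ p ∈ n.primeFactors \ m.primeFactors, (1 - (p : ℚ)⁻¹) := by
    symm
    refine Finset.prod_subset_one_on_sdiff Finset.sdiff_subset (fun p hp => ?_) fun p hp => ?_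
    · have hp' : p ∈ m.primeFactors := by
        by_contra h
        simp only [Finset.mem_sdiff] at hp
        exact hp.2 ⟨hp.1, h⟩
      have : ¬ m.Coprime p := fun h => by
        have h2 := (Nat.Prime.coprime_iff_not_dvd (Nat.prime_of_mem_primeFactors hp')).mp h.symm
        exact h2 (Nat.dvd_of_mem_primeFactors hp')
      simp [invCoprime, this]
    · rw [Finset.mem_sdiff] at hp
      have hpp := Nat.prime_of_mem_primeFactors hp.1
      have : m.Coprime p := by
        refine ((Nat.Prime.coprime_iff_not_dvd hpp).mpr fun h => hp.2 ?_).symm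
        exact Nat.mem_primeFactors.mpr ⟨hpp, h, hm⟩
      simp [invCoprime, this]
  rw [h1, Nat.totient_eq_mul_prod_factors, Nat.totient_eq_mul_prod_factors,
    Nat.primeFactors_mul hn hm, ← Finset.sdiff_union_self_eq_union,
    Finset.prod_union Finset.sdiff_disjoint]
  push_cast
  ring

/-- The Möbius-inverse form of `deltaExponent_eq`. -/
theorem sum_divisors_mul_moebius {N n : ℕ} (hN : N ≠ 0) (hn : n ∣ N) :
    ∑ i ∈ n.divisors, (i : ℤ) * ArithmeticFunction.moebius (N / i) =
      ArithmeticFunction.moebius (N / n) * ((N.totient / (N / n).totient : ℕ) : ℤ) := by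
  obtain ⟨m, rfl⟩ := hn
  have hn0 : n ≠ 0 := left_ne_zero_of_mul hN
  have hm0 : m ≠ 0 := right_ne_zero_of_mul hN
  rw [Nat.mul_div_cancel_left m (Nat.pos_of_ne_zero hn0)]
  have h1 : ∑ i ∈ n.divisors, (i : ℤ) * ArithmeticFunction.moebius (n * m / i) =
      ∑ d ∈ n.divisors, ((n / d : ℕ) : ℤ) * ArithmeticFunction.moebius (m * d) := by
    rw [← Nat.sum_div_divisors n]
    refine Finset.sum_congr rfl fun d hd => ?_
    obtain ⟨e, rfl⟩ := Nat.dvd_of_mem_divisors hd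
    have hd0 : 0 < d := Nat.pos_of_ne_zero (left_ne_zero_of_mul hn0)
    have he0 : 0 < e := Nat.pos_of_ne_zero (right_ne_zero_of_mul hn0)
    rw [Nat.mul_div_cancel_left e hd0, show d * e * m = e * (m * d) by ring,
      Nat.mul_div_cancel_left _ he0]
  rw [h1]
  have hq : (m.totient : ℚ) ≠ 0 := by
    exact_mod_cast (Nat.totient_pos.mpr (Nat.pos_of_ne_zero hm0)).ne'
  refine Int.cast_injective (α := ℚ) ?_
  rw [Int.cast_mul, Int.cast_natCast,
    Nat.cast_div_charZero (Nat.totient_dvd_of_dvd (Dvd.intro_left n rfl)),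
    totient_mul_eq n m hn0 hm0, ← sum_divisors_moebius_mul (isMultiplicative_invCoprime m) hn0,
    Int.cast_sum, mul_assoc, mul_div_cancel_left₀ _ hq, Finset.mul_sum, Finset.mul_sum]
  refine Finset.sum_congr rfl fun d hd => ?_
  rw [moebius_mul, Int.cast_mul, Int.cast_natCast,
    Nat.cast_div_charZero (Nat.dvd_of_mem_divisors hd)]
  by_cases h : m.Coprime d
  · simp only [invCoprime, ArithmeticFunction.coe_mk, if_pos h, Int.cast_mul]
    ring
  · simp [h, invCoprime]

/-- The exponents `a(t)` in closed form. -/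
theorem deltaExponent_eq {N t : ℕ} (hN : N ≠ 0) (ht : t ∣ N) :
    deltaExponent N t = t * ArithmeticFunction.moebius (N / t) := by
  have h := (ArithmeticFunction.sum_eq_iff_sum_mul_moebius_eq_on (R := ℤ)
    (f := fun t => (t : ℤ) * ArithmeticFunction.moebius (N / t))
    (g := fun n => ArithmeticFunction.moebius (N / n) * ((N.totient / (N / n).totient : ℕ) : ℤ))
    {n | n ∣ N} fun _ _ => Nat.dvd_trans).mp
    (fun n _ hn => sum_divisors_mul_moebius hN hn) t
    (Nat.pos_of_ne_zero (ne_zero_of_dvd_ne_zero hN ht)) ht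
  simp only [Int.cast_id] at h
  rw [← h, Nat.sum_divisorsAntidiagonal' (f := fun a b => ArithmeticFunction.moebius a *
    (ArithmeticFunction.moebius (N / b) * ((N.totient / (N / b).totient : ℕ) : ℤ)))]
  exact Finset.sum_congr rfl fun r _ => mul_assoc _ _ _

theorem sum_moebius_mul_eq_totient (N : ℕ) (hN : N ≠ 0) :
    ∑ t ∈ N.divisors, (t : ℤ) * ArithmeticFunction.moebius (N / t) = N.totient := by
  rw [sum_divisors_mul_moebius hN dvd_rfl, Nat.div_self (Nat.pos_of_ne_zero hN)]
  simp

/-! ### The pole at `s = 1` -/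

theorem meromorphicAt_riemannZeta_one : MeromorphicAt riemannZeta 1 := by
  set h : ℂ → ℂ := Function.update (fun s => (s - 1) * riemannZeta s) 1 1
  have hne : ∀ s ≠ (1 : ℂ), h s = (s - 1) * riemannZeta s := fun s hs =>
    Function.update_of_ne hs _ _
  have hcont : ContinuousAt h 1 := continuousAt_update_same.mpr riemannZeta_residue_one
  have hdiff : ∀ᶠ s in 𝓝[≠] (1 : ℂ), DifferentiableAt ℂ h s := by
    filter_upwards [self_mem_nhdsWithin] with s hs
    have hs' : s ≠ 1 := hs
    have h1 : DifferentiableAt ℂ (fun s => (s - 1) * riemannZeta s) s :=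
      (by fun_prop : DifferentiableAt ℂ (fun s : ℂ => s - 1) s).mul
        (differentiableAt_riemannZeta hs')
    refine h1.congr_of_eventuallyEq ?_
    filter_upwards [isOpen_compl_singleton.mem_nhds hs'] with t ht using hne t ht
  have han := (Complex.analyticAt_of_differentiable_on_punctured_nhds_of_continuousAt
    hdiff hcont).meromorphicAt
  have hlin : MeromorphicAt (fun s : ℂ => (s - 1)⁻¹) 1 :=
    (analyticAt_id.sub analyticAt_const).meromorphicAt.inv
  refine (hlin.mul han).congr ?_
  filter_upwards [self_mem_nhdsWithin] with s hs
  have hs' : s - 1 ≠ 0 := sub_ne_zero.mpr hs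
  rw [Pi.mul_apply, hne s hs, inv_mul_cancel_left₀ hs']

theorem analyticAt_of_differentiableAt_halfPlane {f : ℂ → ℂ}
    (hf : ∀ s : ℂ, 1 / 2 < s.re → DifferentiableAt ℂ f s) : AnalyticAt ℂ f 1 := by
  refine DifferentiableOn.analyticAt (s := {s : ℂ | 1 / 2 < s.re})
    (fun s hs => (hf s hs).differentiableWithinAt) ?_
  exact (isOpen_lt continuous_const Complex.continuous_re).mem_nhds (by norm_num)

/-- The Gamma factor of `ζ^*(2 s - 1)`. -/
def gammaFactor (s : ℂ) : ℂ :=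
  (Real.pi : ℂ) ^ (-(2 * s - 1) / 2) * Complex.Gamma ((2 * s - 1) / 2)

theorem differentiableAt_gammaFactor {s : ℂ} (hs : 1 / 2 < s.re) :
    DifferentiableAt ℂ gammaFactor s := by
  refine DifferentiableAt.mul (DifferentiableAt.const_cpow (by fun_prop)
    (Or.inl (by simp [Real.pi_ne_zero]))) ?_
  refine DifferentiableAt.comp s (Complex.differentiableAt_Gamma _ fun n h => ?_) (by fun_prop)
  have h' : 2 * s = 1 - 2 * n := by linear_combination 2 * h
  have := congrArg Complex.re h'
  simp at this
  linarith [(Nat.cast_nonneg n : (0 : ℝ) ≤ n)]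

theorem gammaFactor_one : gammaFactor 1 = 1 := by
  have hpi : (Real.pi : ℂ) ≠ 0 := Complex.ofReal_ne_zero.mpr Real.pi_ne_zero
  rw [gammaFactor, show (2 * 1 - 1 : ℂ) / 2 = 1 / 2 by norm_num, Complex.Gamma_one_half_eq,
    ← Complex.cpow_add _ _ hpi]
  norm_num

theorem meromorphicAt_zetaStar : MeromorphicAt (fun s : ℂ => zetaStar (2 * s - 1)) 1 := by
  have h1 : MeromorphicAt gammaFactor 1 :=
    (analyticAt_of_differentiableAt_halfPlane fun s hs =>
      differentiableAt_gammaFactor hs).meromorphicAt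
  have h2 : MeromorphicAt (riemannZeta ∘ fun s : ℂ => 2 * s - 1) 1 := by
    refine MeromorphicAt.comp_analyticAt ?_ (by fun_prop)
    norm_num
    exact meromorphicAt_riemannZeta_one
  exact h1.mul h2

theorem tendsto_sub_one_mul_zetaStar :
    Tendsto (fun s : ℂ => (s - 1) * zetaStar (2 * s - 1)) (𝓝[≠] 1) (𝓝 (1 / 2)) := by
  have h1 : Tendsto (fun s : ℂ => 2 * s - 1) (𝓝[≠] 1) (𝓝[≠] 1) := by
    refine tendsto_nhdsWithin_iff.mpr ⟨?_, ?_⟩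
    · refine Tendsto.mono_left ?_ nhdsWithin_le_nhds
      have : ContinuousAt (fun s : ℂ => 2 * s - 1) 1 := by fun_prop
      simpa [ContinuousAt, show (2 - 1 : ℂ) = 1 by norm_num] using this
    · filter_upwards [self_mem_nhdsWithin] with s hs h
      refine hs (?_ : s = 1)
      have h' : 2 * s - 1 = 1 := h
      linear_combination h' / 2
  have h2 : Tendsto gammaFactor (𝓝[≠] 1) (𝓝 1) := by
    have := (differentiableAt_gammaFactor (s := 1) (by norm_num)).continuousAt.tendsto
    rw [gammaFactor_one] at this
    exact this.mono_left nhdsWithin_le_nhds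
  have h3 := (h2.mul (riemannZeta_residue_one.comp h1)).mul_const (1 / 2 : ℂ)
  rw [one_mul, one_mul] at h3
  refine h3.congr fun s => ?_
  simp only [Function.comp, gammaFactor, zetaStar]
  ring

theorem tendsto_zetaStar_mul_cpow_sub_one {y : ℝ} (hy : 0 < y) :
    Tendsto (fun s : ℂ => zetaStar (2 * s - 1) * ((y : ℂ) ^ (1 - s) - 1)) (𝓝[≠] 1)
      (𝓝 ((-(1 / 2) * Real.log y : ℝ) : ℂ)) := by
  have hy' : (y : ℂ) ≠ 0 := Complex.ofReal_ne_zero.mpr hy.ne'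
  have h1 : HasDerivAt (fun s : ℂ => (y : ℂ) ^ (1 - s)) (-Complex.log y) 1 := by
    have h := ((hasDerivAt_id (1 : ℂ)).const_sub 1).const_cpow (c := (y : ℂ)) (Or.inl hy')
    simpa using h
  have h2 := tendsto_sub_one_mul_zetaStar.mul (hasDerivAt_iff_tendsto_slope.mp h1)
  have h3 : (1 / 2 : ℂ) * -Complex.log y = ((-(1 / 2) * Real.log y : ℝ) : ℂ) := by
    rw [← Complex.ofReal_log hy.le]
    push_cast
    ring
  rw [h3] at h2
  refine h2.congr' ?_
  filter_upwards [self_mem_nhdsWithin] with s hs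
  have hs' : s - 1 ≠ 0 := sub_ne_zero.mpr hs
  rw [slope_def_field, sub_self, Complex.cpow_zero]
  field_simp

/-! ### The limit formula -/

/-- The part of the continued Eisenstein series that is holomorphic at `s = 1`. -/
def levelRegularPart (N : ℕ) (z : ℍ) (s : ℂ) : ℂ :=
  ∑ t ∈ N.divisors, (ArithmeticFunction.moebius (N / t) : ℂ) * (t : ℂ) ^ s *
    regularPart (scaled t z) s

/-- The continuation of the normalized Eisenstein series to `Re s > 1 / 2`. -/
def continuedEisenstein (N : ℕ) (z : ℍ) (s : ℂ) : ℂ :=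
  levelRegularPart N z s + (N.totient : ℂ) * zetaStar (2 * s - 1) * (z.im : ℂ) ^ (1 - s)

/-- The factor `t ^ s` cancels the dependence on `t` of the exponent in `(t y) ^ (1 - s)`, so the
polar terms add up to a multiple of `y ^ (1 - s)`. -/
theorem continuedEisenstein_eq (N : ℕ) [NeZero N] (z : ℍ) {s : ℂ} (hs : 1 < s.re) :
    continuedEisenstein N z s = normalizedEisenstein N z s := by
  have htot : (N.totient : ℂ) = ∑ t ∈ N.divisors,
      (t : ℂ) * (ArithmeticFunction.moebius (N / t) : ℂ) := by
    have := congrArg (Int.cast (R := ℂ)) (sum_moebius_mul_eq_totient N (NeZero.ne N))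
    push_cast at this
    exact this.symm
  rw [normalizedEisenstein_eq N z hs, continuedEisenstein, levelRegularPart, htot, Finset.sum_mul,
    Finset.sum_mul, ← Finset.sum_add_distrib]
  refine Finset.sum_congr rfl fun t ht => ?_
  have ht0 : t ≠ 0 := (Nat.pos_of_mem_divisors ht).ne'
  have h1 : (t : ℂ) ^ s * ((scaled t z).im : ℂ) ^ (1 - s) = t * (z.im : ℂ) ^ (1 - s) := by
    rw [im_scaled ht0, Complex.ofReal_mul,
      Complex.mul_cpow_ofReal_nonneg (Nat.cast_nonneg t) z.im_pos.le, ← mul_assoc,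
      Complex.ofReal_natCast, ← Complex.cpow_add _ _ (Nat.cast_ne_zero.mpr ht0), add_sub_cancel,
      Complex.cpow_one]
  rw [completed_latticeSum_eq (scaled t z) hs]
  linear_combination (-(ArithmeticFunction.moebius (N / t) : ℂ) * zetaStar (2 * s - 1)) * h1

theorem analyticAt_levelRegularPart (N : ℕ) (z : ℍ) : AnalyticAt ℂ (levelRegularPart N z) 1 := by
  refine analyticAt_of_differentiableAt_halfPlane fun s hs => ?_
  refine DifferentiableAt.fun_sum fun t ht => ?_
  have ht0 : (t : ℂ) ≠ 0 := Nat.cast_ne_zero.mpr (Nat.pos_of_mem_divisors ht).ne'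
  exact ((differentiableAt_id.const_cpow (Or.inl ht0)).const_mul _).mul
    (differentiableAt_regularPart _ hs)

theorem levelRegularPart_one (N : ℕ) (hN : N ≠ 0) (z : ℍ) :
    levelRegularPart N z 1 = ((-(1 / 12) * Real.log ‖DeltaN N z‖ : ℝ) : ℂ) := by
  have h1 : Real.log ‖DeltaN N z‖ = ∑ t ∈ N.divisors,
      (deltaExponent N t : ℝ) * Real.log ‖ModularForm.discriminant (scaled t z)‖ := by
    rw [DeltaN, norm_prod, Real.log_prod fun t _ => ?_]
    · refine Finset.sum_congr rfl fun t _ => ?_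
      rw [norm_zpow, Real.log_zpow, scaled]
    · exact norm_ne_zero_iff.mpr (zpow_ne_zero _ (ModularForm.discriminant_ne_zero _))
  rw [h1, levelRegularPart, Finset.mul_sum, Complex.ofReal_sum]
  refine Finset.sum_congr rfl fun t ht => ?_
  rw [deltaExponent_eq hN (Nat.dvd_of_mem_divisors ht), regularPart_one, Complex.cpow_one]
  push_cast
  ring

theorem meromorphicAt_continuedEisenstein (N : ℕ) (z : ℍ) :
    MeromorphicAt (continuedEisenstein N z) 1 := by
  have h : AnalyticAt ℂ (fun s : ℂ => (z.im : ℂ) ^ (1 - s)) 1 :=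
    analyticAt_of_differentiableAt_halfPlane fun s _ =>
      DifferentiableAt.const_cpow (by fun_prop) (Or.inl (by simp [z.im_ne_zero]))
  exact (analyticAt_levelRegularPart N z).meromorphicAt.add
    (((MeromorphicAt.const _ _).mul meromorphicAt_zetaStar).mul h.meromorphicAt)

theorem tendsto_continuedEisenstein_sub (N : ℕ) [NeZero N] (z : ℍ) :
    Tendsto (fun s : ℂ => continuedEisenstein N z s - (N.totient : ℂ) * zetaStar (2 * s - 1))
      (𝓝[≠] 1)
      (𝓝 ((-(1 / 12) * Real.log (z.im ^ (6 * N.totient) * ‖DeltaN N z‖) : ℝ) : ℂ)) := by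
  have h1 : Tendsto (levelRegularPart N z) (𝓝[≠] 1) (𝓝 (levelRegularPart N z 1)) :=
    (analyticAt_levelRegularPart N z).continuousAt.tendsto.mono_left nhdsWithin_le_nhds
  have h2 := h1.add ((tendsto_zetaStar_mul_cpow_sub_one z.im_pos).const_mul (N.totient : ℂ))
  have hD : ‖DeltaN N z‖ ≠ 0 := by
    rw [DeltaN, norm_ne_zero_iff]
    exact Finset.prod_ne_zero_iff.mpr fun t _ =>
      zpow_ne_zero _ (ModularForm.discriminant_ne_zero _)
  have h3 : levelRegularPart N z 1 + (N.totient : ℂ) * ((-(1 / 2) * Real.log z.im : ℝ) : ℂ) =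
      ((-(1 / 12) * Real.log (z.im ^ (6 * N.totient) * ‖DeltaN N z‖) : ℝ) : ℂ) := by
    rw [levelRegularPart_one N (NeZero.ne N), Real.log_mul (pow_ne_zero _ z.im_ne_zero) hD,
      Real.log_pow]
    push_cast
    ring
  rw [h3] at h2
  refine h2.congr fun s => ?_
  rw [continuedEisenstein]
  ring

/-! ### The Fricke involution -/

theorem im_fricke_smul (N : ℕ) [NeZero N] (z : ℍ) :
    (frickeMatrix N • z).im = z.im / (N * Complex.normSq z) := by
  have hN : (N : ℝ) ≠ 0 := Nat.cast_ne_zero.mpr (NeZero.ne N)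
  rw [← UpperHalfPlane.coe_im, coe_fricke_smul, neg_div, Complex.neg_im, one_div, Complex.inv_im,
    Complex.normSq_mul, Complex.normSq_natCast]
  have hz : Complex.normSq (z : ℂ) ≠ 0 := z.normSq_pos.ne'
  simp
  field_simp

/-- The function `y ^ (6 φ(N)) |Δ_N|` at `w_N z` is `y ^ (6 φ(N)) |Δ_N ^ 0|` at `z`. -/
theorem im_pow_mul_norm_DeltaN_fricke (N : ℕ) [NeZero N] (z : ℍ) :
    (frickeMatrix N • z).im ^ (6 * N.totient) * ‖DeltaN N (frickeMatrix N • z)‖ =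
      z.im ^ (6 * N.totient) * ‖DeltaN0 N z‖ := by
  have hN : (0 : ℝ) < N := Nat.cast_pos.mpr (NeZero.pos N)
  have hdet : (frickeMatrix N).det.val = (N : ℝ) := by
    simp [frickeMatrix, Matrix.GeneralLinearGroup.mkOfDetNeZero, Matrix.det_fin_two]
  have hden : UpperHalfPlane.denom (frickeMatrix N) z = N * z := by
    simp [UpperHalfPlane.denom, frickeMatrix, Matrix.GeneralLinearGroup.mkOfDetNeZero]
  have hz : ‖(z : ℂ)‖ ≠ 0 := norm_ne_zero_iff.mpr z.ne_zero
  have hpow : (N : ℝ) ^ (((12 * N.totient : ℕ) : ℝ) / 2) = (N : ℝ) ^ (6 * N.totient) := by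
    rw [← Real.rpow_natCast]
    congr 1
    push_cast
    ring
  rw [DeltaN0, slash, hdet, hden, hpow, im_fricke_smul, norm_mul, norm_mul, norm_zpow, norm_mul,
    Complex.norm_real, Complex.norm_natCast, Real.norm_of_nonneg (by positivity), ← mul_assoc]
  congr 1
  rw [Complex.normSq_eq_norm_sq, zpow_neg, zpow_natCast,
    show 12 * N.totient = 2 * (6 * N.totient) by ring, pow_mul _ 2, ← inv_pow, ← mul_pow, ← mul_pow]
  congr 1
  field_simp

end KroneckerGamma0

end

/-- The Kronecker limit formula for `Γ₀(N)`. The function `𝓔 z` is the analytic continuation of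
the normalized Eisenstein series from `Re s > 1`, where the series converges absolutely, to a
punctured neighbourhood of `s = 1`; the conditions determine it near `s = 1`. -/
theorem theorem1p4 (N : ℕ) [NeZero N] :
    ∃ 𝓔 : ℍ → ℂ → ℂ,
      (∀ (z : ℍ) (s : ℂ), 1 < s.re →
        Summable (KroneckerGamma0.eisensteinTerm N z s) ∧
          𝓔 z s = KroneckerGamma0.normalizedEisenstein N z s) ∧
      (∀ z : ℍ, MeromorphicAt (𝓔 z) 1) ∧
      (∀ z : ℍ,
        Tendsto
          (fun s : ℂ => 𝓔 z s - (Nat.totient N : ℂ) * KroneckerGamma0.zetaStar (2 * s - 1))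
          (𝓝[≠] 1)
          (𝓝 ((-(1 / 12) * Real.log (z.im ^ (6 * Nat.totient N) *
            ‖KroneckerGamma0.DeltaN N z‖) : ℝ) : ℂ))) ∧
      (∀ z : ℍ,
        Tendsto
          (fun s : ℂ => 𝓔 (KroneckerGamma0.frickeMatrix N • z) s -
            (Nat.totient N : ℂ) * KroneckerGamma0.zetaStar (2 * s - 1))
          (𝓝[≠] 1)
          (𝓝 ((-(1 / 12) * Real.log (z.im ^ (6 * Nat.totient N) *
            ‖KroneckerGamma0.DeltaN0 N z‖) : ℝ) : ℂ))) := by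
  refine ⟨KroneckerGamma0.continuedEisenstein N, fun z s hs =>
    ⟨KroneckerGamma0.summable_eisensteinTerm N z hs,
      KroneckerGamma0.continuedEisenstein_eq N z hs⟩,
    KroneckerGamma0.meromorphicAt_continuedEisenstein N,
    KroneckerGamma0.tendsto_continuedEisenstein_sub N, fun z => ?_⟩
  rw [← KroneckerGamma0.im_pow_mul_norm_DeltaN_fricke]
  exact KroneckerGamma0.tendsto_continuedEisenstein_sub N (KroneckerGamma0.frickeMatrix N • z)
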